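/- Let $B,C>0$, $0<\varepsilon<1/2$, $b\ge 1$ and $\lambda\ge 0$. Let $\Omega=(-1,1)^2$, let $S_0$ be the space of symmetric traceless real $2\times2$ matrices with $|\mathbf P|^2=\operatorname{tr}(\mathbf P^2)$, and consider the rescaled reduced Landau--de Gennes energy $$E[\mathbf P]=\int_\Omega \frac1{2b^2}|\mathbf P_x|^2+\frac12|\mathbf P_y|^2+\frac{\lambda^2}{2C}\Big(-\frac{B^2}{4C}|\mathbf P|^2+\frac C4|\mathbf P|^4\Big)\,dA$$ on the admissible space $\mathcal A=\{\mathbf P\in H^1(\Omega;S_0):\ \mathbf P=\mathbf P_{bc}\text{ on }\partial\Omega\}$. Here the boundary condition is understood in the sense of traces, $$\mathbf P_{bc}(\pm1,y)=\frac{B}{2C}\begin{pmatrix}-T_\varepsilon(y)&0\\0&T_\varepsilon(y)\end{pmatrix},\qquad \mathbf P_{bc}(x,\pm1)=\frac{B}{2C}\begin{pmatrix}T_\varepsilon(x)&0\\0&-T_\varepsilon(x)\end{pmatrix},$$ and $T_\varepsilon(t)=(1+t)/\varepsilon$ for $-1\le t\le-1+\varepsilon$, $T_\varepsilon(t)=1$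 for $|t|\le1-\varepsilon$, $T_\varepsilon(t)=(1-t)/\varepsilon$ for $1-\varepsilon\le t\le1$. A critical point of $E$ in $\mathcal A$ is a $\mathbf P\in\mathcal A$ such that $\frac{d}{dt}E[\mathbf P+t\mathbf V]\big|_{t=0}=0$ for every $\mathbf V\in H^1_0(\Omega;S_0)$; the energy is finite at all the fields $\mathbf P+t\mathbf V$. Consider also the scalar energy $$H(p)=\int_\Omega \frac1{b^2}p_x^2+p_y^2+\frac{\lambda^2}{2C}\Big(-\frac{B^2}{2C}p^2+Cp^4\Big)\,dA$$ on the functions $p\in H^1(\Omega)$ with $p=(\mathbf P_{bc})_{11}$ on $\partial\Omega$, where $H$ is finite. Then $E$ has a critical point $\mathbf P\in\mathcal A$ with $P_{12}\equiv0$ in $\Omega$ such that $P_{11}$ minimizes $H$ in this class. Moreover, for every minimizer $p$ of $H$ in this class, $\begin{pmatrix}p&0\\0&-p\end{pmatrix}\in\mathcal A$ is a critical point of $E$. -/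

import Mathlib

open MeasureTheory Set
open scoped ContDiff

noncomputable section

namespace RLdG

/-- The (open) rescaled square `(-1,1) × (-1,1)`. -/
def Omega : Set (ℝ × ℝ) := Ioo (-1) 1 ×ˢ Ioo (-1) 1

/-- Lebesgue measure on the square. -/
def mu : Measure (ℝ × ℝ) := volume.restrict Omega

/-- Test functions: smooth functions with compact support inside the square. -/
def IsTest (φ : ℝ × ℝ → ℝ) : Prop :=
  ContDiff ℝ ∞ φ ∧ HasCompactSupport φ ∧ tsupport φ ⊆ Omega

/-- `g` is a weak derivative of `u` on the square in the direction `v`, and `g ∈ L²`. -/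
def IsWeakDeriv (v : ℝ × ℝ) (u g : ℝ × ℝ → ℝ) : Prop :=
  MemLp g 2 mu ∧
    ∀ φ, IsTest φ → ∫ z, u z * fderiv ℝ φ z v ∂mu = -∫ z, g z * φ z ∂mu

/-- The unit vectors giving the two coordinate directions. -/
def ex : ℝ × ℝ := (1, 0)

def ey : ℝ × ℝ := (0, 1)

/-- The Sobolev space `H¹` of the square. -/
def MemH1 (u : ℝ × ℝ → ℝ) : Prop :=
  MemLp u 2 mu ∧ (∃ g, IsWeakDeriv ex u g) ∧ (∃ g, IsWeakDeriv ey u g)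

open Classical in
/-- The weak derivative in the direction `v` (unique up to null sets when it exists). -/
def weakDeriv (v : ℝ × ℝ) (u : ℝ × ℝ → ℝ) : ℝ × ℝ → ℝ :=
  if h : ∃ g, IsWeakDeriv v u g then h.choose else 0

/-- `H¹₀`: the closure of the test functions in `H¹`. -/
def MemH10 (u : ℝ × ℝ → ℝ) : Prop :=
  MemH1 u ∧ ∀ δ : ℝ, 0 < δ → ∃ φ, IsTest φ ∧
    eLpNorm (fun z => u z - φ z) 2 mu < ENNReal.ofReal δ ∧
    eLpNorm (fun z => weakDeriv ex u z - fderiv ℝ φ z ex) 2 mu < ENNReal.ofReal δ ∧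
    eLpNorm (fun z => weakDeriv ey u z - fderiv ℝ φ z ey) 2 mu < ENNReal.ofReal δ

/-- Matrix fields on the plane; only their values on the square matter. -/
abbrev Field : Type := ℝ × ℝ → Matrix (Fin 2) (Fin 2) ℝ

/-- The space `S₀` of symmetric traceless `2 × 2` matrices. -/
def S0 : Set (Matrix (Fin 2) (Fin 2) ℝ) := {M | M.IsSymm ∧ M.trace = 0}

/-- `H¹(Ω; S₀)`. -/
def MemH1S0 (P : Field) : Prop :=
  (∀ i j, MemH1 fun z => P z i j) ∧ ∀ᵐ z ∂mu, P z ∈ S0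

/-- `H¹₀(Ω; S₀)`, the space of admissible variations. -/
def MemH10S0 (V : Field) : Prop :=
  (∀ i j, MemH10 fun z => V z i j) ∧ ∀ᵐ z ∂mu, V z ∈ S0

/-- The trapezoidal profile `T_ε`. -/
def T (ε t : ℝ) : ℝ :=
  if t ≤ -1 + ε then (1 + t) / ε else if t ≤ 1 - ε then 1 else (1 - t) / ε

/-- A Lipschitz function on the plane whose restriction to the boundary of the square is the
`(1,1)` entry of the tangent boundary datum; see `bc11_vertical`, `bc11_horizontal` and
`lipschitz_bc11` below. -/
def bc11 (B C ε : ℝ) (z : ℝ × ℝ) : ℝ := B / (2 * C) * (T ε z.1 - T ε z.2)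

/-- The boundary datum `P_bc`, given by a Lipschitz extension. -/
def Pbc (B C ε : ℝ) : Field := fun z => !![bc11 B C ε z, 0; 0, -bc11 B C ε z]

theorem T_one {ε : ℝ} (h0 : 0 < ε) (h1 : ε < 1 / 2) : T ε 1 = 0 := by
  unfold T
  rw [if_neg (by linarith), if_neg (by linarith)]
  simp

theorem T_neg_one {ε : ℝ} (h0 : 0 < ε) : T ε (-1) = 0 := by
  unfold T
  rw [if_pos (by linarith)]
  simp

theorem T_eq_min {ε : ℝ} (h0 : 0 < ε) (h1 : ε < 1 / 2) (t : ℝ) :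
    T ε t = min ((1 + t) / ε) (min 1 ((1 - t) / ε)) := by
  unfold T
  split_ifs with h h'
  · rw [min_eq_left]
    refine le_min ?_ ?_
    · rw [div_le_one h0]; linarith
    · exact div_le_div_of_nonneg_right (by linarith) h0.le
  · rw [min_eq_left (a := (1 : ℝ)), min_eq_right]
    · rw [le_div_iff₀ h0]; linarith
    · rw [le_div_iff₀ h0]; linarith
  · rw [min_eq_right (a := (1 : ℝ)), min_eq_right]
    · exact div_le_div_of_nonneg_right (by linarith) h0.le
    · rw [div_le_one h0]; linarith

/-- On the edges `x = ±1` the datum is `-(B/2C) T_ε(y)`. -/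
theorem bc11_vertical (B C : ℝ) {ε : ℝ} (h0 : 0 < ε) (h1 : ε < 1 / 2) (y : ℝ) :
    bc11 B C ε (1, y) = B / (2 * C) * -T ε y ∧ bc11 B C ε (-1, y) = B / (2 * C) * -T ε y := by
  simp [bc11, T_one h0 h1, T_neg_one h0]

/-- On the edges `y = ±1` the datum is `(B/2C) T_ε(x)`. -/
theorem bc11_horizontal (B C : ℝ) {ε : ℝ} (h0 : 0 < ε) (h1 : ε < 1 / 2) (x : ℝ) :
    bc11 B C ε (x, 1) = B / (2 * C) * T ε x ∧ bc11 B C ε (x, -1) = B / (2 * C) * T ε x := by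
  simp [bc11, T_one h0 h1, T_neg_one h0]

theorem lipschitz_T {ε : ℝ} (h0 : 0 < ε) (h1 : ε < 1 / 2) : ∃ K, LipschitzWith K (T ε) := by
  have e : T ε = fun t => min ((1 + t) / ε) (min 1 ((1 - t) / ε)) := funext (T_eq_min h0 h1)
  have a : LipschitzWith (Real.toNNReal (1 / ε)) fun t : ℝ => (1 + t) / ε :=
    LipschitzWith.of_dist_le' fun x y => by
      rw [Real.dist_eq, Real.dist_eq, ← sub_div, abs_div, abs_of_pos h0]
      ring_nf
      exact le_rfl
  have c : LipschitzWith (Real.toNNReal (1 / ε)) fun t : ℝ => (1 - t) / ε :=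
    LipschitzWith.of_dist_le' fun x y => by
      rw [Real.dist_eq, Real.dist_eq, ← sub_div, abs_div, abs_of_pos h0, abs_sub_comm x y]
      ring_nf
      exact le_rfl
  rw [e]
  exact ⟨_, a.min ((LipschitzWith.const (1 : ℝ)).min c)⟩

theorem lipschitz_bc11 (B C : ℝ) {ε : ℝ} (h0 : 0 < ε) (h1 : ε < 1 / 2) :
    ∃ K, LipschitzWith K (bc11 B C ε) := by
  obtain ⟨K, hK⟩ := lipschitz_T h0 h1
  exact ⟨_, (lipschitzWith_smul (B / (2 * C))).comp
    ((hK.comp LipschitzWith.prod_fst).sub (hK.comp LipschitzWith.prod_snd))⟩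

/-- The admissible space `𝒜`: fields in `H¹(Ω; S₀)` with `P = P_bc` on the boundary, that is,
`P - P_bc ∈ H¹₀`. -/
def Admissible (B C ε : ℝ) (P : Field) : Prop :=
  MemH1S0 P ∧ ∀ i j, MemH10 fun z => P z i j - Pbc B C ε z i j

/-- `|M|² = tr (M M)`. -/
def normSq (M : Matrix (Fin 2) (Fin 2) ℝ) : ℝ := (M * M).trace

/-- Entrywise weak derivative of a matrix field. -/
def weakDerivField (v : ℝ × ℝ) (P : Field) : Field :=
  fun z => Matrix.of fun i j => weakDeriv v (fun w => P w i j) z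

/-- The density of the rescaled reduced Landau--de Gennes energy. -/
def energyDensity (B C b lam : ℝ) (P : Field) (z : ℝ × ℝ) : ℝ :=
  1 / (2 * b ^ 2) * normSq (weakDerivField ex P z) + 1 / 2 * normSq (weakDerivField ey P z)
    + lam ^ 2 / (2 * C) * (-(B ^ 2 / (4 * C)) * normSq (P z) + C / 4 * normSq (P z) ^ 2)

/-- The rescaled reduced Landau--de Gennes energy. -/
def energy (B C b lam : ℝ) (P : Field) : ℝ := ∫ z, energyDensity B C b lam P z ∂mu

/-- `P` is a critical point of the energy on `𝒜`: the energy is finite along every line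
`P + t V` with `V ∈ H¹₀(Ω; S₀)`, and its first variation at `P` vanishes. -/
def IsCriticalPoint (B C b lam ε : ℝ) (P : Field) : Prop :=
  Admissible B C ε P ∧ ∀ V, MemH10S0 V →
    (∀ t : ℝ, Integrable (energyDensity B C b lam (P + t • V)) mu) ∧
    HasDerivAt (fun t : ℝ => energy B C b lam (P + t • V)) 0 0

/-- The class of scalar functions with the Dirichlet data of `P₁₁`. -/
def ScalarAdmissible (B C ε : ℝ) (p : ℝ × ℝ → ℝ) : Prop :=
  MemH1 p ∧ MemH10 fun z => p z - bc11 B C ε z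

/-- The density of the scalar energy `H`. -/
def scalarDensity (B C b lam : ℝ) (p : ℝ × ℝ → ℝ) (z : ℝ × ℝ) : ℝ :=
  1 / b ^ 2 * weakDeriv ex p z ^ 2 + weakDeriv ey p z ^ 2
    + lam ^ 2 / (2 * C) * (-(B ^ 2 / (2 * C)) * p z ^ 2 + C * p z ^ 4)

/-- The scalar energy `H`. -/
def scalarEnergy (B C b lam : ℝ) (p : ℝ × ℝ → ℝ) : ℝ := ∫ z, scalarDensity B C b lam p z ∂mu

/-- `p` minimizes `H` under the Dirichlet data; `H` is finite on the whole class. -/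
def IsScalarMinimizer (B C b lam ε : ℝ) (p : ℝ × ℝ → ℝ) : Prop :=
  ScalarAdmissible B C ε p ∧ ∀ q, ScalarAdmissible B C ε q →
    Integrable (scalarDensity B C b lam q) mu ∧
    scalarEnergy B C b lam p ≤ scalarEnergy B C b lam q

end RLdG

end

noncomputable section

namespace RLdG

open Filter Topology
open scoped ENNReal NNReal

/-! On `S₀` one has `|P|² = 2(P₁₁² + P₁₂²)`, so `E` restricted to fields with `P₁₂ = 0` is exactly
`H(P₁₁)`. A variation of such a field in the `P₁₂` direction enters `|P|²` and the gradient terms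
only at order `t²`, hence does not contribute to the first variation of `E`. Criticality of the
diagonal field built from `p` is therefore the Euler--Lagrange equation of `H` at `p`, and every
minimizer of `H` satisfies it (`hasDerivAt_energy_line`,
`IsScalarMinimizer.firstVariation_eq_zero`).

It remains to minimize `H`, which is done by the direct method in a form that avoids weak
convergence. A function is replaced by the triple `(p, p_x, p_y)` in `L⁴ × L² × L²`, and `H¹₀`
becomes the closure of the triples of test functions. The energy is norm-continuous there and
coercive, because the quartic term dominates the negative quadratic one. Its only nonconvex part is
a multiple of `-‖p‖²` in `L²`. Rellich compactness (`totallyBounded_inc_image`) makes a minimizing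
sequence Cauchy in `L²` along a subsequence; the parallelogram identity (`dirichletPart_sub_le`)
then makes the gradients Cauchy, and the Sobolev inequality (`exists_eLpNorm_four_le`) the functions
in `L⁴`. The limit attains the infimum. -/

/-! ### Test functions, weak derivatives and `H¹` on the square. -/

theorem isOpen_Omega : IsOpen Omega := isOpen_Ioo.prod isOpen_Ioo

theorem measurableSet_Omega : MeasurableSet Omega := isOpen_Omega.measurableSet

theorem Omega_subset_Icc : Omega ⊆ Icc (-1) 1 ×ˢ Icc (-1) 1 :=
  prod_mono Ioo_subset_Icc_self Ioo_subset_Icc_self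

theorem isBounded_Omega : Bornology.IsBounded Omega :=
  (isCompact_Icc.prod isCompact_Icc).isBounded.subset Omega_subset_Icc

instance isFiniteMeasure_mu : IsFiniteMeasure mu :=
  isFiniteMeasure_restrict.2 isBounded_Omega.measure_lt_top.ne

instance fact_one_le_four : Fact ((1 : ENNReal) ≤ 4) := ⟨by norm_num⟩

namespace IsTest

variable {φ ψ : ℝ × ℝ → ℝ}

theorem add (hφ : IsTest φ) (hψ : IsTest ψ) : IsTest fun z => φ z + ψ z :=
  ⟨hφ.1.add hψ.1, hφ.2.1.add hψ.2.1, (tsupport_add φ ψ).trans (union_subset hφ.2.2 hψ.2.2)⟩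

theorem const_mul (hφ : IsTest φ) (c : ℝ) : IsTest fun z => c * φ z :=
  ⟨contDiff_const.mul hφ.1, hφ.2.1.mul_left, (tsupport_mul_subset_right).trans hφ.2.2⟩

theorem zero : IsTest fun _ => 0 :=
  ⟨contDiff_const, HasCompactSupport.zero, by simp [tsupport]⟩

theorem differentiable (hφ : IsTest φ) : Differentiable ℝ φ := hφ.1.differentiable (by simp)

theorem continuous_fderiv (hφ : IsTest φ) : Continuous (fderiv ℝ φ) :=
  hφ.1.continuous_fderiv (by simp)

theorem continuous_fderiv_apply (hφ : IsTest φ) (v : ℝ × ℝ) :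
    Continuous fun z => fderiv ℝ φ z v := hφ.continuous_fderiv.clm_apply continuous_const

theorem hasCompactSupport_fderiv_apply (hφ : IsTest φ) (v : ℝ × ℝ) :
    HasCompactSupport fun z => fderiv ℝ φ z v := hφ.2.1.fderiv_apply ℝ v

theorem memLp (hφ : IsTest φ) (p : ENNReal) : MemLp φ p mu :=
  (hφ.1.continuous.memLp_of_hasCompactSupport hφ.2.1).restrict _

theorem memLp_fderiv (hφ : IsTest φ) (v : ℝ × ℝ) (p : ENNReal) :
    MemLp (fun z => fderiv ℝ φ z v) p mu :=
  ((hφ.continuous_fderiv_apply v).memLp_of_hasCompactSupport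
    (hφ.hasCompactSupport_fderiv_apply v)).restrict _

theorem eq_zero (hφ : IsTest φ) {z : ℝ × ℝ} (hz : z ∉ Omega) : φ z = 0 :=
  image_eq_zero_of_notMem_tsupport fun h => hz (hφ.2.2 h)

theorem fderiv_eq_zero (hφ : IsTest φ) {z : ℝ × ℝ} (hz : z ∉ Omega) : fderiv ℝ φ z = 0 :=
  image_eq_zero_of_notMem_tsupport fun h => hz (hφ.2.2 (tsupport_fderiv_subset ℝ h))

theorem fderiv_add (hφ : IsTest φ) (hψ : IsTest ψ) (z v : ℝ × ℝ) :
    fderiv ℝ (fun z => φ z + ψ z) z v = fderiv ℝ φ z v + fderiv ℝ ψ z v := by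
  rw [fderiv_fun_add (hφ.differentiable z) (hψ.differentiable z)]; rfl

theorem fderiv_const_mul (hφ : IsTest φ) (c : ℝ) (z v : ℝ × ℝ) :
    fderiv ℝ (fun z => c * φ z) z v = c * fderiv ℝ φ z v := by
  rw [_root_.fderiv_const_mul (hφ.differentiable z)]; rfl

end IsTest

theorem _root_.MeasureTheory.MemLp.integrable_mul_two {α : Type*} {m : MeasurableSpace α}
    {μ : Measure α} {f g : α → ℝ} (hf : MemLp f 2 μ) (hg : MemLp g 2 μ) :
    Integrable (fun z => f z * g z) μ := MemLp.integrable_mul hf hg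

namespace IsWeakDeriv

variable {v : ℝ × ℝ} {u u' g g' : ℝ × ℝ → ℝ}

/-- The fundamental lemma of the calculus of variations, applied to `g - g'`. It makes the chosen
representative `weakDeriv` interchangeable with any known weak derivative. -/
theorem ae_eq (h : IsWeakDeriv v u g) (h' : IsWeakDeriv v u g') : g =ᵐ[mu] g' := by
  have hd : MemLp (fun z => g z - g' z) 2 mu := h.1.sub h'.1
  have key := isOpen_Omega.ae_eq_zero_of_integral_contDiff_smul_eq_zero
    (f := fun z => g z - g' z) (μ := volume)
    (IntegrableOn.locallyIntegrableOn (hd.integrable (by norm_num))) ?_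
  · rw [Filter.EventuallyEq, mu, ae_restrict_iff' measurableSet_Omega]
    filter_upwards [key] with z hz hzO
    linarith [hz hzO]
  · intro φ h1 h2 h3
    have hφ : IsTest φ := ⟨h1, h2, h3⟩
    rw [← setIntegral_eq_integral_of_forall_compl_eq_zero (s := Omega)
      (fun z hz => by simp [hφ.eq_zero hz])]
    change ∫ z, φ z • (g z - g' z) ∂mu = 0
    have e1 := h.2 φ hφ
    have e2 := h'.2 φ hφ
    have : ∀ z, φ z • (g z - g' z) = g z * φ z - g' z * φ z := fun z => by
      simp only [smul_eq_mul]; ring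
    simp_rw [this]
    rw [integral_sub (h.1.integrable_mul_two (hφ.memLp 2))
      (h'.1.integrable_mul_two (hφ.memLp 2))]
    linarith

theorem congr (h : IsWeakDeriv v u g) (hu : u =ᵐ[mu] u') (hg : g =ᵐ[mu] g') :
    IsWeakDeriv v u' g' := by
  refine ⟨(memLp_congr_ae hg).1 h.1, fun φ hφ => ?_⟩
  have e1 : ∫ z, u' z * fderiv ℝ φ z v ∂mu = ∫ z, u z * fderiv ℝ φ z v ∂mu :=
    integral_congr_ae (by filter_upwards [hu] with z hz; rw [hz])
  have e2 : ∫ z, g' z * φ z ∂mu = ∫ z, g z * φ z ∂mu :=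
    integral_congr_ae (by filter_upwards [hg] with z hz; rw [hz])
  rw [e1, e2, h.2 φ hφ]

theorem add (hu : MemLp u 2 mu) (hu' : MemLp u' 2 mu) (h : IsWeakDeriv v u g)
    (h' : IsWeakDeriv v u' g') :
    IsWeakDeriv v (fun z => u z + u' z) (fun z => g z + g' z) := by
  refine ⟨h.1.add h'.1, fun φ hφ => ?_⟩
  simp_rw [add_mul]
  rw [integral_add (hu.integrable_mul_two (hφ.memLp_fderiv v 2))
    (hu'.integrable_mul_two (hφ.memLp_fderiv v 2)),
    integral_add (h.1.integrable_mul_two (hφ.memLp 2)) (h'.1.integrable_mul_two (hφ.memLp 2)),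
    h.2 φ hφ, h'.2 φ hφ]
  ring

theorem const_mul (h : IsWeakDeriv v u g) (c : ℝ) :
    IsWeakDeriv v (fun z => c * u z) (fun z => c * g z) := by
  refine ⟨h.1.const_mul c, fun φ hφ => ?_⟩
  simp_rw [mul_assoc]
  rw [integral_const_mul, integral_const_mul, h.2 φ hφ]
  ring

theorem zero : IsWeakDeriv v (fun _ => 0) (fun _ => 0) := ⟨MemLp.zero, fun φ hφ => by simp⟩

theorem isWeakDeriv_weakDeriv (h : IsWeakDeriv v u g) : IsWeakDeriv v u (weakDeriv v u) := by
  have hex : ∃ g, IsWeakDeriv v u g := ⟨g, h⟩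
  rw [weakDeriv, dif_pos hex]
  exact hex.choose_spec

theorem weakDeriv_ae_eq (h : IsWeakDeriv v u g) : weakDeriv v u =ᵐ[mu] g :=
  h.isWeakDeriv_weakDeriv.ae_eq h

end IsWeakDeriv

/-- Integration by parts for two Lipschitz functions on the whole plane; `φ` and its derivative
vanish off the square, so no boundary term appears. The boundary datum, being merely Lipschitz, has
its weak derivatives from here. -/
theorem _root_.LipschitzWith.integral_mul_fderiv_test {K : NNReal} {f φ : ℝ × ℝ → ℝ}
    (hf : LipschitzWith K f) (hφ : IsTest φ) (v : ℝ × ℝ) :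
    ∫ z, f z * fderiv ℝ φ z v ∂mu = -∫ z, lineDeriv ℝ f z v * φ z ∂mu := by
  have hφ1 : ContDiff ℝ 1 φ := hφ.1.of_le (by simp)
  obtain ⟨D, hD⟩ := hφ1.lipschitzWith_of_hasCompactSupport hφ.2.1 (by simp)
  have key := LipschitzWith.integral_lineDeriv_mul_eq (μ := volume) hf hD hφ.2.1 v
  have e1 : ∫ z, lineDeriv ℝ f z v * φ z ∂mu = ∫ z, lineDeriv ℝ f z v * φ z :=
    setIntegral_eq_integral_of_forall_compl_eq_zero fun z hz => by simp [hφ.eq_zero hz]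
  have e2 : ∫ z, f z * fderiv ℝ φ z v ∂mu = ∫ z, f z * fderiv ℝ φ z v :=
    setIntegral_eq_integral_of_forall_compl_eq_zero fun z hz => by simp [hφ.fderiv_eq_zero hz]
  rw [e1, e2, key, ← integral_neg]
  refine integral_congr_ae (ae_of_all _ fun z => ?_)
  simp only [(hφ.differentiable z).lineDeriv_eq_fderiv, map_neg]
  ring

theorem _root_.LipschitzWith.isWeakDeriv_lineDeriv {K : NNReal} {f : ℝ × ℝ → ℝ}
    (hf : LipschitzWith K f) (v : ℝ × ℝ) : IsWeakDeriv v f (fun z => lineDeriv ℝ f z v) := by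
  refine ⟨?_, fun φ hφ => hf.integral_mul_fderiv_test hφ v⟩
  have h : MemLp (fun z => lineDeriv ℝ f z v) ⊤ mu :=
    (hf.memLp_lineDeriv (μ := volume) v).restrict Omega
  exact h.mono_exponent le_top

theorem IsTest.isWeakDeriv {φ : ℝ × ℝ → ℝ} (hφ : IsTest φ) (v : ℝ × ℝ) :
    IsWeakDeriv v φ fun z => fderiv ℝ φ z v := by
  obtain ⟨D, hD⟩ := (hφ.1.of_le (by simp) : ContDiff ℝ 1 φ).lipschitzWith_of_hasCompactSupport
    hφ.2.1 (by simp)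
  refine (hD.isWeakDeriv_lineDeriv v).congr (ae_of_all _ fun _ => rfl) (ae_of_all _ fun z => ?_)
  exact (hφ.differentiable z).lineDeriv_eq_fderiv

theorem _root_.LipschitzWith.memLp_mu {K : NNReal} {f : ℝ × ℝ → ℝ}
    (hf : LipschitzWith K f) (p : ENNReal) : MemLp f p mu := by
  obtain ⟨M, hM⟩ := (isCompact_Icc.prod isCompact_Icc).exists_bound_of_continuousOn
    (s := Icc (-1 : ℝ) 1 ×ˢ Icc (-1 : ℝ) 1) hf.continuous.continuousOn
  refine MemLp.of_bound hf.continuous.aestronglyMeasurable M ?_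
  filter_upwards [ae_restrict_mem measurableSet_Omega] with z hz
  exact hM z (Omega_subset_Icc hz)

/-- The derivatives of a member of `H¹` in the two coordinate directions exist weakly. -/
theorem MemH1.isWeakDeriv {u : ℝ × ℝ → ℝ} (hu : MemH1 u) :
    IsWeakDeriv ex u (weakDeriv ex u) ∧ IsWeakDeriv ey u (weakDeriv ey u) :=
  ⟨hu.2.1.choose_spec.isWeakDeriv_weakDeriv, hu.2.2.choose_spec.isWeakDeriv_weakDeriv⟩

theorem MemH1.const_mul {u : ℝ × ℝ → ℝ} (hu : MemH1 u) (c : ℝ) : MemH1 fun z => c * u z :=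
  ⟨hu.1.const_mul c, ⟨_, hu.isWeakDeriv.1.const_mul c⟩, ⟨_, hu.isWeakDeriv.2.const_mul c⟩⟩

theorem MemH1.zero : MemH1 fun _ => 0 :=
  ⟨MemLp.zero, ⟨_, IsWeakDeriv.zero⟩, ⟨_, IsWeakDeriv.zero⟩⟩

/-! ### The Sobolev inequality for test functions. -/

theorem norm_clm_le (l : ℝ × ℝ →L[ℝ] ℝ) : ‖l‖ ≤ ‖l ex‖ + ‖l ey‖ := by
  refine l.opNorm_le_bound (by positivity) fun z => ?_
  have hz : z = z.1 • ex + z.2 • ey := by ext <;> simp [ex, ey]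
  have e : l z = z.1 * l ex + z.2 * l ey := by
    conv_lhs => rw [hz]
    simp
  rw [e, add_mul]
  refine (norm_add_le _ _).trans (add_le_add ?_ ?_)
  · rw [norm_mul, mul_comm]
    exact mul_le_mul_of_nonneg_left (norm_fst_le z) (norm_nonneg _)
  · rw [norm_mul, mul_comm]
    exact mul_le_mul_of_nonneg_left (norm_snd_le z) (norm_nonneg _)

namespace IsTest

variable {φ : ℝ × ℝ → ℝ}

theorem support_subset (hφ : IsTest φ) : Function.support φ ⊆ Omega := fun _ hz =>
  by_contra fun h => hz (hφ.eq_zero h)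

theorem support_norm_fderiv_subset (hφ : IsTest φ) :
    Function.support (fun z => ‖fderiv ℝ φ z‖) ⊆ Omega :=
  fun _ hz => by_contra fun h => hz (by simp [hφ.fderiv_eq_zero h])

theorem eLpNorm_volume (hφ : IsTest φ) (p : ℝ≥0∞) : eLpNorm φ p volume = eLpNorm φ p mu := by
  rw [mu, eLpNorm_restrict_eq_of_support_subset hφ.support_subset]

theorem eLpNorm_fderiv_volume (hφ : IsTest φ) (p : ℝ≥0∞) :
    eLpNorm (fderiv ℝ φ) p volume = eLpNorm (fderiv ℝ φ) p mu := by
  rw [← eLpNorm_norm, ← eLpNorm_norm (μ := mu), mu,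
    eLpNorm_restrict_eq_of_support_subset hφ.support_norm_fderiv_subset]

theorem eLpNorm_fderiv_le (hφ : IsTest φ) {p : ℝ≥0∞} (hp : 1 ≤ p) :
    eLpNorm (fderiv ℝ φ) p mu ≤
      eLpNorm (fun z => fderiv ℝ φ z ex) p mu + eLpNorm (fun z => fderiv ℝ φ z ey) p mu := by
  have h1 := (hφ.memLp_fderiv ex p).1.norm
  have h2 := (hφ.memLp_fderiv ey p).1.norm
  refine (eLpNorm_mono_real fun z => norm_clm_le (fderiv ℝ φ z)).trans ?_
  refine (eLpNorm_add_le h1 h2 hp).trans ?_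
  rw [eLpNorm_norm, eLpNorm_norm]

end IsTest

/-- The Gagliardo--Nirenberg--Sobolev inequality on the square. -/
theorem exists_eLpNorm_four_le : ∃ K : ℝ≥0, ∀ φ, IsTest φ → eLpNorm φ 4 mu ≤
    K * (eLpNorm (fun z => fderiv ℝ φ z ex) 2 mu + eLpNorm (fun z => fderiv ℝ φ z ey) 2 mu) := by
  have hm : mu univ ^ (1 / (4 / 3 : ℝ≥0∞).toReal - 1 / (2 : ℝ≥0∞).toReal) ≠ ⊤ := by
    refine ENNReal.rpow_ne_top_of_nonneg ?_ (measure_ne_top _ _)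
    norm_num [ENNReal.toReal_div]
  -- The Sobolev inequality requires an exponent below the dimension 2, so `p = 2` is excluded. The
  -- exponent `4 / 3` has Sobolev conjugate 4, since `3/4 - 1/2 = 1/4`; the finite measure of the
  -- square then bounds the `L^{4/3}` norm of the gradient by its `L²` norm.
  refine ⟨eLpNormLESNormFDerivOfLeConst ℝ (volume : Measure (ℝ × ℝ)) Omega (4 / 3) 4 *
    (mu univ ^ (1 / (4 / 3 : ℝ≥0∞).toReal - 1 / (2 : ℝ≥0∞).toReal)).toNNReal, fun φ hφ => ?_⟩
  have h := eLpNorm_le_eLpNorm_fderiv_of_le (volume : Measure (ℝ × ℝ)) (u := φ) (s := Omega)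
    (p := 4 / 3) (q := 4) (hφ.1.of_le (by simp))
    hφ.support_subset
    (by rw [← NNReal.coe_le_coe]; norm_num)
    (by rw [← NNReal.coe_lt_coe]; norm_num [Module.finrank_prod])
    (by norm_num [Module.finrank_prod]) isBounded_Omega
  have c43 : ((4 / 3 : ℝ≥0) : ℝ≥0∞) = 4 / 3 := by
    rw [ENNReal.coe_div (by norm_num)]; rfl
  rw [c43, hφ.eLpNorm_fderiv_volume, show ((4 : ℝ≥0) : ℝ≥0∞) = 4 from rfl,
    hφ.eLpNorm_volume] at h
  have hle : (4 / 3 : ℝ≥0∞) ≤ 2 := by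
    rw [← c43, show (2 : ℝ≥0∞) = ((2 : ℝ≥0) : ℝ≥0∞) from rfl, ENNReal.coe_le_coe,
      ← NNReal.coe_le_coe]
    norm_num
  have h2 := eLpNorm_le_eLpNorm_mul_rpow_measure_univ (μ := mu) hle
    hφ.continuous_fderiv.aestronglyMeasurable
  refine h.trans ?_
  rw [ENNReal.coe_mul, mul_assoc, ENNReal.coe_toNNReal hm]
  gcongr
  refine h2.trans ?_
  rw [mul_comm]
  gcongr
  exact hφ.eLpNorm_fderiv_le (by norm_num)

/-! ### Towards Rellich's theorem: cell averages control the `L²` norm up to the gradient. -/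

theorem enorm_integral_sq_le {α : Type*} {m : MeasurableSpace α} (ν : Measure α)
    [IsFiniteMeasure ν] {f : α → ℝ} (hf : AEStronglyMeasurable f ν) :
    ‖∫ x, f x ∂ν‖ₑ ^ 2 ≤ ν univ * ∫⁻ x, ‖f x‖ₑ ^ 2 ∂ν := by
  have h := eLpNorm_le_eLpNorm_mul_rpow_measure_univ (μ := ν) (p := 1) (q := 2) (by norm_num) hf
  have h2 : eLpNorm f 2 ν ^ 2 = ∫⁻ x, ‖f x‖ₑ ^ 2 ∂ν := by
    have := eLpNorm_nnreal_pow_eq_lintegral (μ := ν) (f := f) (p := 2) (by norm_num)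
    simpa using this
  rw [eLpNorm_one_eq_lintegral_enorm] at h
  calc ‖∫ x, f x ∂ν‖ₑ ^ 2 ≤ (∫⁻ x, ‖f x‖ₑ ∂ν) ^ 2 := by
        gcongr; exact enorm_integral_le_lintegral_enorm f
    _ ≤ (eLpNorm f 2 ν * ν univ ^ (1 / (1 : ℝ≥0∞).toReal - 1 / (2 : ℝ≥0∞).toReal)) ^ 2 := by
        gcongr
    _ = ν univ * ∫⁻ x, ‖f x‖ₑ ^ 2 ∂ν := by
        rw [mul_pow, h2, mul_comm]
        congr 1
        rw [← ENNReal.rpow_natCast, ← ENNReal.rpow_mul]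
        norm_num

/-- The increment is the integral of the derivative along the segment from `z` to `z + k`.
Cauchy--Schwarz in the segment parameter, Tonelli and translation invariance give the bound. -/
theorem IsTest.lintegral_translate_le {φ : ℝ × ℝ → ℝ} (hφ : IsTest φ) (k : ℝ × ℝ) :
    ∫⁻ z, ‖φ (z + k) - φ z‖ₑ ^ 2 ≤ ‖k‖ₑ ^ 2 * ∫⁻ z, ‖fderiv ℝ φ z‖ₑ ^ 2 := by
  have hc : Continuous fun q : (ℝ × ℝ) × ℝ => fderiv ℝ φ (q.1 + q.2 • k) :=
    hφ.continuous_fderiv.comp (by fun_prop)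
  have hpt : ∀ z, ‖φ (z + k) - φ z‖ₑ ^ 2 ≤
      ‖k‖ₑ ^ 2 * ∫⁻ t in Ioc (0 : ℝ) 1, ‖fderiv ℝ φ (z + t • k)‖ₑ ^ 2 := by
    intro z
    have hcz : Continuous fun t : ℝ => fderiv ℝ φ (z + t • k) k :=
      (hφ.continuous_fderiv.comp (by fun_prop)).clm_apply continuous_const
    have e : φ (z + k) - φ z = ∫ t in Ioc (0 : ℝ) 1, fderiv ℝ φ (z + t • k) k := by
      rw [← intervalIntegral.integral_of_le zero_le_one,
        intervalIntegral.integral_eq_sub_of_hasDerivAt (f := fun t : ℝ => φ (z + t • k))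
          (fun t _ => ?_) (hcz.intervalIntegrable _ _)]
      · simp
      · have h1 : HasDerivAt (fun t : ℝ => z + t • k) k t := by
          simpa using ((hasDerivAt_id t).smul_const k).const_add z
        exact (hφ.differentiable _).hasFDerivAt.comp_hasDerivAt t h1
    rw [e]
    refine (enorm_integral_sq_le _ hcz.aestronglyMeasurable).trans ?_
    rw [Measure.restrict_apply_univ, Real.volume_Ioc, sub_zero, ENNReal.ofReal_one, one_mul,
      ← lintegral_const_mul' _ _ (by finiteness)]
    refine lintegral_mono fun t => ?_
    rw [← mul_pow, mul_comm]
    gcongr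
    exact (fderiv ℝ φ (z + t • k)).le_opENorm k
  refine (lintegral_mono hpt).trans ?_
  rw [lintegral_const_mul' _ _ (by finiteness)]
  refine mul_le_mul' le_rfl ?_
  rw [lintegral_lintegral_swap
    ((hc.enorm.measurable.pow_const 2).aemeasurable)]
  refine (lintegral_mono fun t => (lintegral_add_right_eq_self
    (fun z => ‖fderiv ℝ φ z‖ₑ ^ 2) (t • k)).le).trans ?_
  simp

/-- The half-open cells of a square grid of mesh `δ`. -/
def cell (δ : ℝ) (i : ℤ × ℤ) : Set (ℝ × ℝ) :=
  Ico (i.1 * δ) ((i.1 + 1) * δ) ×ˢ Ico (i.2 * δ) ((i.2 + 1) * δ)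

theorem measurableSet_cell (δ : ℝ) (i : ℤ × ℤ) : MeasurableSet (cell δ i) :=
  measurableSet_Ico.prod measurableSet_Ico

theorem volume_cell (δ : ℝ) (i : ℤ × ℤ) :
    volume (cell δ i) = ENNReal.ofReal δ ^ 2 := by
  rw [cell, Measure.volume_eq_prod, Measure.prod_prod, Real.volume_Ico, Real.volume_Ico, sq]
  congr 2 <;> ring

theorem mem_cell {δ : ℝ} (hδ : 0 < δ) (i : ℤ × ℤ) (z : ℝ × ℝ) :
    z ∈ cell δ i ↔ (⌊z.1 / δ⌋, ⌊z.2 / δ⌋) = i := by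
  rw [Prod.ext_iff, Int.floor_eq_iff, Int.floor_eq_iff, le_div_iff₀ hδ, le_div_iff₀ hδ,
    div_lt_iff₀ hδ, div_lt_iff₀ hδ]
  exact Iff.rfl

theorem pairwise_disjoint_cell {δ : ℝ} (hδ : 0 < δ) :
    Pairwise (Function.onFun Disjoint (cell δ)) := fun i j hij =>
  Set.disjoint_left.2 fun z hi hj => hij
    (((mem_cell hδ i z).1 hi).symm.trans ((mem_cell hδ j z).1 hj))

theorem cell_subset_closedBall {δ : ℝ} {i : ℤ × ℤ} {z : ℝ × ℝ}
    (hz : z ∈ cell δ i) : cell δ i ⊆ Metric.closedBall z δ := by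
  intro w hw
  obtain ⟨⟨a, b⟩, c, d⟩ := hz
  obtain ⟨⟨a', b'⟩, c', d'⟩ := hw
  rw [Metric.mem_closedBall, Prod.dist_eq, max_le_iff, Real.dist_eq, Real.dist_eq, abs_le, abs_le]
  refine ⟨⟨?_, ?_⟩, ?_, ?_⟩ <;> nlinarith

/-- For fixed `z`, the area of the cell times `φ z` equals `∫ φ - ∫ (φ w - φ z) dw`. Squaring,
applying Cauchy--Schwarz to the second integral and integrating over `z` in the cell gives the
estimate. -/
theorem lintegral_cell_le {δ : ℝ} (i : ℤ × ℤ) {φ : ℝ × ℝ → ℝ} (hφ : IsTest φ) :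
    ENNReal.ofReal δ ^ 4 * ∫⁻ z in cell δ i, ‖φ z‖ₑ ^ 2 ≤
      2 * ENNReal.ofReal δ ^ 2 * (‖∫ z in cell δ i, φ z‖ₑ ^ 2 +
        ∫⁻ z in cell δ i, ∫⁻ w in cell δ i, ‖φ w - φ z‖ₑ ^ 2) := by
  have hv : volume (cell δ i) ≠ ⊤ := by rw [volume_cell]; finiteness
  have : IsFiniteMeasure (volume.restrict (cell δ i)) := isFiniteMeasure_restrict.2 hv
  have hi : Integrable φ (volume.restrict (cell δ i)) :=
    (hφ.1.continuous.integrable_of_hasCompactSupport hφ.2.1).restrict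
  have hpt : ∀ z, ENNReal.ofReal δ ^ 4 * ‖φ z‖ₑ ^ 2 ≤
      2 * (‖∫ w in cell δ i, φ w‖ₑ ^ 2 +
        ENNReal.ofReal δ ^ 2 * ∫⁻ w in cell δ i, ‖φ w - φ z‖ₑ ^ 2) := by
    intro z
    have h1 := enorm_integral_sq_le (volume.restrict (cell δ i))
      (f := fun w => φ w - φ z) (hi.sub (integrable_const _)).1
    rw [integral_sub hi (integrable_const _), Measure.restrict_apply_univ, volume_cell,
      integral_const] at h1
    set I := ∫ w in cell δ i, φ w
    set c := (volume.restrict (cell δ i)).real univ • φ z with hc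
    have h2 : ‖c‖ₑ = ENNReal.ofReal δ ^ 2 * ‖φ z‖ₑ := by
      rw [hc, smul_eq_mul, enorm_mul, measureReal_restrict_apply_univ, measureReal_def,
        volume_cell, Real.enorm_eq_ofReal (by positivity), ENNReal.ofReal_toReal (by finiteness)]
    calc ENNReal.ofReal δ ^ 4 * ‖φ z‖ₑ ^ 2 = ‖c‖ₑ ^ 2 := by rw [h2]; ring
      _ = ‖I - (I - c)‖ₑ ^ 2 := by rw [sub_sub_cancel]
      _ ≤ (‖I‖ₑ + ‖I - c‖ₑ) ^ 2 := by gcongr; exact enorm_sub_le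
      _ ≤ 2 * (‖I‖ₑ ^ 2 + ‖I - c‖ₑ ^ 2) := by
        have := ENNReal.rpow_add_le_mul_rpow_add_rpow ‖I‖ₑ ‖I - c‖ₑ (p := 2) (by norm_num)
        norm_num at this
        exact this
      _ ≤ _ := by gcongr
  rw [← lintegral_const_mul' _ _ (by finiteness)]
  refine (lintegral_mono hpt).trans ?_
  rw [lintegral_const_mul' _ _ (by finiteness), lintegral_add_left (by fun_prop),
    lintegral_const, lintegral_const_mul' _ _ (by finiteness), Measure.restrict_apply_univ,
    volume_cell]
  apply le_of_eq
  ring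

/-- After substituting `w = z + k` and exchanging integrals, each translate contributes at most `δ²`
times the Dirichlet integral. The ball is that of the sup norm, a square of area `4 δ²`. -/
theorem IsTest.lintegral_near_diagonal_le {φ : ℝ × ℝ → ℝ} (hφ : IsTest φ) (δ : ℝ) :
    ∫⁻ z, ∫⁻ w in Metric.closedBall z δ, ‖φ w - φ z‖ₑ ^ 2 ≤
      4 * ENNReal.ofReal δ ^ 4 * ∫⁻ z, ‖fderiv ℝ φ z‖ₑ ^ 2 := by
  have e : ∀ z, ∫⁻ w in Metric.closedBall z δ, ‖φ w - φ z‖ₑ ^ 2 =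
      ∫⁻ k in Metric.closedBall 0 δ, ‖φ (z + k) - φ z‖ₑ ^ 2 := by
    intro z
    rw [← lintegral_indicator Metric.isClosed_closedBall.measurableSet,
      ← lintegral_indicator Metric.isClosed_closedBall.measurableSet,
      ← lintegral_add_left_eq_self _ z]
    congr 1 with k
    simp [indicator, Metric.mem_closedBall, dist_eq_norm]
  simp_rw [e]
  have hc : Continuous φ := hφ.1.continuous
  rw [lintegral_lintegral_swap]
  · have hb : volume (Metric.closedBall (0 : ℝ × ℝ) δ) = 4 * ENNReal.ofReal δ ^ 2 := by
      rw [show (0 : ℝ × ℝ) = (0, 0) from rfl, ← closedBall_prod_same, Measure.volume_eq_prod,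
        Measure.prod_prod, Real.volume_closedBall, ENNReal.ofReal_mul (by norm_num)]
      norm_num
      ring
    calc _ ≤ ∫⁻ k in Metric.closedBall (0 : ℝ × ℝ) δ,
          ENNReal.ofReal δ ^ 2 * ∫⁻ z, ‖fderiv ℝ φ z‖ₑ ^ 2 := by
          refine setLIntegral_mono (by fun_prop) fun k hk => (hφ.lintegral_translate_le k).trans ?_
          gcongr
          rw [← ofReal_norm]
          exact ENNReal.ofReal_le_ofReal (by simpa using hk)
      _ = _ := by
          rw [lintegral_const, Measure.restrict_apply_univ, hb]
          ring
  · exact Measurable.aemeasurable (by fun_prop)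

theorem exists_finset_Omega_subset {δ : ℝ} (hδ : 0 < δ) :
    ∃ s : Finset (ℤ × ℤ), Omega ⊆ ⋃ i ∈ s, cell δ i := by
  refine ⟨Finset.Icc ⌊-1 / δ⌋ ⌊1 / δ⌋ ×ˢ Finset.Icc ⌊-1 / δ⌋ ⌊1 / δ⌋, fun z hz => ?_⟩
  obtain ⟨⟨a, b⟩, c, d⟩ := hz
  simp only [mem_iUnion]
  refine ⟨(⌊z.1 / δ⌋, ⌊z.2 / δ⌋), ?_, (mem_cell hδ _ z).2 rfl⟩
  simp only [Finset.mem_product, Finset.mem_Icc]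
  refine ⟨⟨?_, ?_⟩, ?_, ?_⟩ <;> gcongr

/-- Up to an error controlled by the gradient, the `L²` norm of a test function is controlled by
finitely many averages. -/
theorem exists_finset_lintegral_sq_le {δ : ℝ} (hδ : 0 < δ) :
    ∃ s : Finset (ℤ × ℤ), ∀ φ, IsTest φ →
      ENNReal.ofReal δ ^ 2 * ∫⁻ z, ‖φ z‖ₑ ^ 2 ≤
        2 * ∑ i ∈ s, ‖∫ z in cell δ i, φ z‖ₑ ^ 2 +
          8 * ENNReal.ofReal δ ^ 4 * ∫⁻ z, ‖fderiv ℝ φ z‖ₑ ^ 2 := by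
  obtain ⟨s, hs⟩ := exists_finset_Omega_subset hδ
  refine ⟨s, fun φ hφ => ?_⟩
  have hd : (s : Set (ℤ × ℤ)).PairwiseDisjoint (cell δ) :=
    fun i _ j _ hij => pairwise_disjoint_cell hδ hij
  have hU : ∫⁻ z, ‖φ z‖ₑ ^ 2 ≤ ∑ i ∈ s, ∫⁻ z in cell δ i, ‖φ z‖ₑ ^ 2 := by
    rw [← lintegral_biUnion_finset hd fun i _ => measurableSet_cell δ i,
      setLIntegral_eq_of_support_subset]
    intro z hz
    refine hs (hφ.support_subset fun h => hz ?_)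
    simp [h]
  -- Points of one cell are within `δ` of each other and the cells are disjoint, so all the
  -- cell-by-cell double integrals fit into one integral near the diagonal.
  have hD : ∑ i ∈ s, ∫⁻ z in cell δ i, ∫⁻ w in cell δ i, ‖φ w - φ z‖ₑ ^ 2 ≤
      4 * ENNReal.ofReal δ ^ 4 * ∫⁻ z, ‖fderiv ℝ φ z‖ₑ ^ 2 := by
    refine le_trans ?_ (hφ.lintegral_near_diagonal_le δ)
    calc _ ≤ ∑ i ∈ s, ∫⁻ z in cell δ i, ∫⁻ w in Metric.closedBall z δ, ‖φ w - φ z‖ₑ ^ 2 := by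
          refine Finset.sum_le_sum fun i _ => ?_
          exact setLIntegral_mono' (measurableSet_cell δ i) fun z hz =>
            lintegral_mono_set (cell_subset_closedBall hz)
      _ = ∫⁻ z in ⋃ i ∈ s, cell δ i, ∫⁻ w in Metric.closedBall z δ, ‖φ w - φ z‖ₑ ^ 2 :=
          (lintegral_biUnion_finset hd (fun i _ => measurableSet_cell δ i) _).symm
      _ ≤ _ := setLIntegral_le_lintegral _ _
  have hδ0 : ENNReal.ofReal δ ^ 2 ≠ 0 := by simpa using hδ
  rw [← ENNReal.mul_le_mul_iff_right hδ0 (by finiteness)]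
  calc _ = ENNReal.ofReal δ ^ 4 * ∫⁻ z, ‖φ z‖ₑ ^ 2 := by ring
    _ ≤ ENNReal.ofReal δ ^ 4 * ∑ i ∈ s, ∫⁻ z in cell δ i, ‖φ z‖ₑ ^ 2 := by gcongr
    _ ≤ ∑ i ∈ s, 2 * ENNReal.ofReal δ ^ 2 * (‖∫ z in cell δ i, φ z‖ₑ ^ 2 +
        ∫⁻ z in cell δ i, ∫⁻ w in cell δ i, ‖φ w - φ z‖ₑ ^ 2) := by
        rw [Finset.mul_sum]
        refine Finset.sum_le_sum fun i _ => ?_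
        exact lintegral_cell_le i hφ
    _ = 2 * ENNReal.ofReal δ ^ 2 * (∑ i ∈ s, ‖∫ z in cell δ i, φ z‖ₑ ^ 2 +
        ∑ i ∈ s, ∫⁻ z in cell δ i, ∫⁻ w in cell δ i, ‖φ w - φ z‖ₑ ^ 2) := by
        rw [← Finset.mul_sum, Finset.sum_add_distrib]
    _ ≤ 2 * ENNReal.ofReal δ ^ 2 * (∑ i ∈ s, ‖∫ z in cell δ i, φ z‖ₑ ^ 2 +
        4 * ENNReal.ofReal δ ^ 4 * ∫⁻ z, ‖fderiv ℝ φ z‖ₑ ^ 2) := by gcongr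
    _ = _ := by ring

/-- A bounded set on which the distance is controlled, up to arbitrarily small errors, by finitely
many continuous linear functionals is totally bounded. -/
theorem totallyBounded_of_finite_functionals {E : Type} [NormedAddCommGroup E] [NormedSpace ℝ E]
    {S : Set E} (hS : Bornology.IsBounded S)
    (h : ∀ ε > (0 : ℝ), ∃ (ι : Type) (_ : Fintype ι) (T : E →L[ℝ] ι → ℝ) (c : ℝ),
      ∀ x ∈ S, ∀ y ∈ S, ‖x - y‖ ^ 2 ≤ c * ‖T (x - y)‖ ^ 2 + ε) : TotallyBounded S := by
  refine Metric.totallyBounded_of_finite_discretization fun ε hε => ?_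
  obtain ⟨ι, _, T, c, hT⟩ := h (ε ^ 2 / 2) (by positivity)
  -- The target is finite-dimensional, so a bounded image is totally bounded. Points of `S` are
  -- classified by a nearby centre of a finite `η`-net of the image; two points with the same centre
  -- have images within `2 * η`.
  have hTS : TotallyBounded (T '' S) :=
    (T.lipschitz.isBounded_image hS).isCompact_closure.totallyBounded.subset subset_closure
  obtain ⟨η, hη, hη'⟩ : ∃ η > (0 : ℝ), |c| * (2 * η) ^ 2 < ε ^ 2 / 2 := by
    have hc : Continuous fun η : ℝ => |c| * (2 * η) ^ 2 := by fun_prop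
    have h0 : ∀ᶠ η in 𝓝[>] (0 : ℝ), |c| * (2 * η) ^ 2 < ε ^ 2 / 2 :=
      (hc.continuousAt.eventually (gt_mem_nhds (by simp; positivity))).filter_mono
        nhdsWithin_le_nhds
    obtain ⟨η, h1, h2⟩ := (h0.and self_mem_nhdsWithin).exists
    exact ⟨η, h2, h1⟩
  obtain ⟨t, ht, hcov⟩ := Metric.totallyBounded_iff.1 hTS η hη
  have hch : ∀ x : S, ∃ y : t, dist (T x) y < η := fun x => by
    have := hcov (mem_image_of_mem T x.2)
    simp only [mem_iUnion, Metric.mem_ball] at this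
    obtain ⟨y, hy, hd⟩ := this
    exact ⟨⟨y, hy⟩, hd⟩
  choose F hF using hch
  have := ht.fintype
  refine ⟨Fin (Fintype.card t), inferInstance, fun x => Fintype.equivFin t (F x),
    fun x y hxy => ?_⟩
  have hxy' : F x = F y := (Fintype.equivFin t).injective hxy
  have h1 : ‖T (x - y)‖ ≤ 2 * η := by
    rw [map_sub, ← dist_eq_norm]
    have a := hF x
    have b := hF y
    rw [← hxy', dist_comm] at b
    linarith [dist_triangle (T x) (F x) (T y)]
  rw [dist_eq_norm]
  refine lt_of_pow_lt_pow_left₀ 2 hε.le ?_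
  calc ‖(x : E) - y‖ ^ 2 ≤ c * ‖T (x - y)‖ ^ 2 + ε ^ 2 / 2 := hT x x.2 y y.2
    _ ≤ |c| * (2 * η) ^ 2 + ε ^ 2 / 2 := by
        gcongr
        exact le_abs_self c
    _ < ε ^ 2 := by linarith

/-! ### Triples of test functions and Rellich compactness. -/

theorem inc_aux (u : Lp ℝ 4 mu) : (u : (ℝ × ℝ) →ₘ[mu] ℝ) ∈ Lp ℝ 2 mu :=
  Lp.antitone (by norm_num) u.2

/-- The inclusion of `L⁴` in `L²` on the square. -/
def inc : Lp ℝ 4 mu →L[ℝ] Lp ℝ 2 mu :=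
  LinearMap.mkContinuous
    { toFun := fun u => ⟨u, inc_aux u⟩
      map_add' := fun _ _ => rfl
      map_smul' := fun _ _ => rfl }
    (mu univ ^ (1 / (2 : ℝ≥0∞).toReal - 1 / (4 : ℝ≥0∞).toReal)).toReal (fun u => by
      have hm : mu univ ^ (1 / (2 : ℝ≥0∞).toReal - 1 / (4 : ℝ≥0∞).toReal) ≠ ⊤ := by
        refine ENNReal.rpow_ne_top_of_nonneg ?_ (measure_ne_top _ _)
        norm_num
      have h := eLpNorm_le_eLpNorm_mul_rpow_measure_univ (μ := mu) (p := 2) (q := 4)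
        (by norm_num) (Lp.memLp u).1
      rw [Lp.norm_def, Lp.norm_def, mul_comm, ← ENNReal.toReal_mul]
      exact ENNReal.toReal_mono (ENNReal.mul_ne_top (Lp.eLpNorm_ne_top u) hm) h)

theorem coe_inc (u : Lp ℝ 4 mu) : (inc u : ℝ × ℝ → ℝ) = u := rfl

/-- The space in which a function of class `H¹₀` is identified with the triple formed by itself and
its two partial derivatives. -/
abbrev Triple : Type := Lp ℝ 4 mu × Lp ℝ 2 mu × Lp ℝ 2 mu

/-- The triple `(φ, φ_x, φ_y)` of a test function. -/
def IsTest.triple {φ : ℝ × ℝ → ℝ} (hφ : IsTest φ) : Triple :=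
  ((hφ.memLp 4).toLp φ, (hφ.memLp_fderiv ex 2).toLp _, (hφ.memLp_fderiv ey 2).toLp _)

theorem IsTest.inc_triple {φ : ℝ × ℝ → ℝ} (hφ : IsTest φ) :
    inc hφ.triple.1 = (hφ.memLp 2).toLp φ := rfl

theorem toLp_eq_add {p : ℝ≥0∞} {f g h : ℝ × ℝ → ℝ} (hf : MemLp f p mu) (hg : MemLp g p mu)
    (hh : MemLp h p mu) (e : ∀ z, h z = f z + g z) : hh.toLp h = hf.toLp f + hg.toLp g := by
  rw [← MemLp.toLp_add]
  exact MemLp.toLp_congr _ _ (ae_of_all _ e)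

theorem toLp_eq_smul {p : ℝ≥0∞} {f h : ℝ × ℝ → ℝ} (hf : MemLp f p mu) (hh : MemLp h p mu)
    (c : ℝ) (e : ∀ z, h z = c * f z) : hh.toLp h = c • hf.toLp f := by
  rw [← MemLp.toLp_const_smul]
  exact MemLp.toLp_congr _ _ (ae_of_all _ e)

theorem IsTest.triple_add {φ ψ : ℝ × ℝ → ℝ} (hφ : IsTest φ) (hψ : IsTest ψ) :
    (hφ.add hψ).triple = hφ.triple + hψ.triple :=
  Prod.ext (toLp_eq_add (hφ.memLp 4) (hψ.memLp 4) ((hφ.add hψ).memLp 4) fun _ => rfl)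
    (Prod.ext (toLp_eq_add (hφ.memLp_fderiv ex 2) (hψ.memLp_fderiv ex 2)
      ((hφ.add hψ).memLp_fderiv ex 2) fun z => hφ.fderiv_add hψ z ex)
      (toLp_eq_add (hφ.memLp_fderiv ey 2) (hψ.memLp_fderiv ey 2)
        ((hφ.add hψ).memLp_fderiv ey 2) fun z => hφ.fderiv_add hψ z ey))

theorem IsTest.triple_const_mul {φ : ℝ × ℝ → ℝ} (hφ : IsTest φ) (c : ℝ) :
    (hφ.const_mul c).triple = c • hφ.triple :=
  Prod.ext (toLp_eq_smul (hφ.memLp 4) ((hφ.const_mul c).memLp 4) c fun _ => rfl)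
    (Prod.ext (toLp_eq_smul (hφ.memLp_fderiv ex 2) ((hφ.const_mul c).memLp_fderiv ex 2) c
        fun z => hφ.fderiv_const_mul c z ex)
      (toLp_eq_smul (hφ.memLp_fderiv ey 2) ((hφ.const_mul c).memLp_fderiv ey 2) c
        fun z => hφ.fderiv_const_mul c z ey))

/-- The triples of the test functions. -/
def testTriples : Submodule ℝ Triple where
  carrier := {x | ∃ (φ : ℝ × ℝ → ℝ) (hφ : IsTest φ), x = hφ.triple}
  zero_mem' := ⟨_, IsTest.zero.const_mul 0, by
    rw [IsTest.zero.triple_const_mul, zero_smul]⟩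
  add_mem' := by
    rintro _ _ ⟨φ, hφ, rfl⟩ ⟨ψ, hψ, rfl⟩
    exact ⟨_, hφ.add hψ, (hφ.triple_add hψ).symm⟩
  smul_mem' := by
    rintro c _ ⟨φ, hφ, rfl⟩
    exact ⟨_, hφ.const_mul c, (hφ.triple_const_mul c).symm⟩

/-- On test triples the gradient components alone control the whole norm. This gives both coercivity
and the passage from Cauchy gradients to Cauchy triples. -/
theorem exists_norm_fst_le :
    ∃ K : ℝ≥0, ∀ x ∈ testTriples, ‖x.1‖ ≤ K * (‖x.2.1‖ + ‖x.2.2‖) := by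
  obtain ⟨K, hK⟩ := exists_eLpNorm_four_le
  refine ⟨K, ?_⟩
  rintro _ ⟨φ, hφ, rfl⟩
  have h1 := (hφ.memLp_fderiv ex 2).2.ne
  have h2 := (hφ.memLp_fderiv ey 2).2.ne
  have h := ENNReal.toReal_mono (by finiteness) (hK φ hφ)
  rw [ENNReal.toReal_mul, ENNReal.toReal_add h1 h2] at h
  simpa [IsTest.triple, Lp.norm_toLp] using h

/-- Cell integrals are inner products with indicators, hence continuous functionals on `L²`. The
factor `s.card` comes from bounding a sum of squares by the sup norm on `s → ℝ`. -/
theorem exists_functionals_norm_sq_le {δ : ℝ} (hδ : 0 < δ) :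
    ∃ s : Finset (ℤ × ℤ), ∃ T : Lp ℝ 2 mu →L[ℝ] (s → ℝ), ∀ x ∈ testTriples,
      δ ^ 2 * ‖inc x.1‖ ^ 2 ≤
        2 * s.card * ‖T (inc x.1)‖ ^ 2 + 8 * δ ^ 4 * (‖x.2.1‖ + ‖x.2.2‖) ^ 2 := by
  obtain ⟨s, hs⟩ := exists_finset_lintegral_sq_le hδ
  refine ⟨s, ContinuousLinearMap.pi fun i => innerSL ℝ (indicatorConstLp 2
    (measurableSet_cell δ i) (measure_ne_top mu _) (1 : ℝ)), ?_⟩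
  rintro _ ⟨φ, hφ, rfl⟩
  set T := ContinuousLinearMap.pi fun i : s => innerSL ℝ (indicatorConstLp 2
    (measurableSet_cell δ i) (measure_ne_top mu (cell δ i)) (1 : ℝ)) with hT
  have hTi : ∀ i : s, ∫ z in cell δ i, φ z = T (inc hφ.triple.1) i := fun i => by
    rw [hT]
    simp only [ContinuousLinearMap.coe_pi', innerSL_apply_apply]
    rw [L2.inner_indicatorConstLp_one, hφ.inc_triple,
      setIntegral_congr_ae (g := φ) (measurableSet_cell δ i)
        ((hφ.memLp 2).coeFn_toLp.mono fun z hz _ => hz), mu,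
      Measure.restrict_restrict (measurableSet_cell δ i), inter_comm,
      ← Measure.restrict_restrict measurableSet_Omega]
    exact (setIntegral_eq_integral_of_forall_compl_eq_zero fun z hz => hφ.eq_zero hz).symm
  have h := hs φ hφ
  have e2 : ∀ {F : Type} [NormedAddCommGroup F] (f : ℝ × ℝ → F),
      ∫⁻ z, ‖f z‖ₑ ^ 2 = eLpNorm f 2 volume ^ 2 := fun f => by
    have := eLpNorm_nnreal_pow_eq_lintegral (μ := (volume : Measure (ℝ × ℝ))) (f := f) (p := 2)
      (by norm_num)
    simpa using this.symm
  rw [e2, e2, hφ.eLpNorm_volume, hφ.eLpNorm_fderiv_volume] at h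
  have n1 : eLpNorm φ 2 mu = ENNReal.ofReal ‖inc hφ.triple.1‖ := by
    rw [hφ.inc_triple, Lp.norm_toLp, ENNReal.ofReal_toReal (hφ.memLp 2).2.ne]
  have n2 : eLpNorm (fderiv ℝ φ) 2 mu ≤
      ENNReal.ofReal (‖hφ.triple.2.1‖ + ‖hφ.triple.2.2‖) := by
    refine (hφ.eLpNorm_fderiv_le (by norm_num)).trans_eq ?_
    rw [ENNReal.ofReal_add (norm_nonneg _) (norm_nonneg _), IsTest.triple, Lp.norm_toLp,
      Lp.norm_toLp, ENNReal.ofReal_toReal (hφ.memLp_fderiv ex 2).2.ne,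
      ENNReal.ofReal_toReal (hφ.memLp_fderiv ey 2).2.ne]
  have n3 : ∑ i ∈ s, ‖∫ z in cell δ i, φ z‖ₑ ^ 2 ≤
      ENNReal.ofReal (s.card * ‖T (inc hφ.triple.1)‖ ^ 2) := by
    rw [ENNReal.ofReal_mul (by positivity), ENNReal.ofReal_natCast, ← nsmul_eq_mul]
    refine Finset.sum_le_card_nsmul _ _ _ fun i hi => ?_
    rw [ENNReal.ofReal_pow (norm_nonneg _), ← ofReal_norm, hTi ⟨i, hi⟩]
    gcongr
    exact norm_le_pi_norm _ _
  rw [← ENNReal.ofReal_le_ofReal_iff (by positivity)]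
  calc ENNReal.ofReal (δ ^ 2 * ‖inc hφ.triple.1‖ ^ 2)
      = ENNReal.ofReal δ ^ 2 * eLpNorm φ 2 mu ^ 2 := by
        rw [n1, ENNReal.ofReal_mul (by positivity), ENNReal.ofReal_pow hδ.le,
          ENNReal.ofReal_pow (norm_nonneg _)]
    _ ≤ _ := h
    _ ≤ 2 * ENNReal.ofReal (s.card * ‖T (inc hφ.triple.1)‖ ^ 2) +
        8 * ENNReal.ofReal δ ^ 4 *
          ENNReal.ofReal (‖hφ.triple.2.1‖ + ‖hφ.triple.2.2‖) ^ 2 := by gcongr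
    _ = _ := by
        rw [mul_assoc 2, ENNReal.ofReal_add (p := 2 * _) (by positivity) (by positivity),
          ENNReal.ofReal_mul (p := 2) zero_le_two, ENNReal.ofReal_mul (p := 8 * δ ^ 4) (by positivity),
          ENNReal.ofReal_mul (p := 8) (by norm_num), ENNReal.ofReal_pow hδ.le,
          ENNReal.ofReal_pow (by positivity)]
        norm_num

/-- The Rellich compactness theorem on the square. -/
theorem totallyBounded_inc_image (M : ℝ) :
    TotallyBounded ((fun x : Triple => inc x.1) '' {x | x ∈ testTriples ∧ ‖x‖ ≤ M}) := by
  refine totallyBounded_of_finite_functionals ?_ fun ε hε => ?_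
  · refine isBounded_iff_forall_norm_le.2 ⟨‖inc‖ * M, ?_⟩
    rintro _ ⟨x, hx, rfl⟩
    exact (inc.le_opNorm _).trans (by gcongr; exact (norm_fst_le x).trans hx.2)
  -- After division by `δ ^ 2` the gradient error is of order `δ ^ 2`. The factor `4 * M` bounds the
  -- two gradient components of a difference of triples of norm at most `M`.
  · obtain ⟨δ, hδ, hδ'⟩ : ∃ δ > (0 : ℝ), 8 * δ ^ 2 * (4 * M) ^ 2 < ε := by
      have hc : Continuous fun δ : ℝ => 8 * δ ^ 2 * (4 * M) ^ 2 := by fun_prop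
      have h0 : ∀ᶠ δ in 𝓝[>] (0 : ℝ), 8 * δ ^ 2 * (4 * M) ^ 2 < ε :=
        (hc.continuousAt.eventually (gt_mem_nhds (by simpa using hε))).filter_mono
          nhdsWithin_le_nhds
      obtain ⟨δ, h1, h2⟩ := (h0.and self_mem_nhdsWithin).exists
      exact ⟨δ, h2, h1⟩
    obtain ⟨s, T, hT⟩ := exists_functionals_norm_sq_le hδ
    refine ⟨s, inferInstance, T, 2 * s.card / δ ^ 2, ?_⟩
    rintro _ ⟨x, hx, rfl⟩ _ ⟨y, hy, rfl⟩
    have h := hT (x - y) (testTriples.sub_mem hx.1 hy.1)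
    simp only [Prod.fst_sub, map_sub, Prod.snd_sub] at h ⊢
    have b1 : ‖x.2.1 - y.2.1‖ + ‖x.2.2 - y.2.2‖ ≤ 4 * M := by
      have := norm_sub_le x.2.1 y.2.1
      have := norm_sub_le x.2.2 y.2.2
      have := (norm_fst_le x.2).trans ((norm_snd_le x).trans hx.2)
      have := (norm_snd_le x.2).trans ((norm_snd_le x).trans hx.2)
      have := (norm_fst_le y.2).trans ((norm_snd_le y).trans hy.2)
      have := (norm_snd_le y.2).trans ((norm_snd_le y).trans hy.2)
      linarith
    have b2 : (‖x.2.1 - y.2.1‖ + ‖x.2.2 - y.2.2‖) ^ 2 ≤ (4 * M) ^ 2 := by gcongr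
    have hδ2 : 0 < δ ^ 2 := by positivity
    rw [← mul_le_mul_iff_right₀ hδ2]
    calc _ ≤ _ := h
      _ ≤ 2 * s.card * ‖T (inc x.1) - T (inc y.1)‖ ^ 2 + 8 * δ ^ 4 * (4 * M) ^ 2 := by gcongr
      _ = 2 * s.card * ‖T (inc x.1) - T (inc y.1)‖ ^ 2 + δ ^ 2 * (8 * δ ^ 2 * (4 * M) ^ 2) := by
        ring
      _ ≤ 2 * s.card * ‖T (inc x.1) - T (inc y.1)‖ ^ 2 + δ ^ 2 * ε := by gcongr
      _ = _ := by field_simp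

theorem cauchySeq_of_mem_testTriples {y : ℕ → Triple} (hy : ∀ n, y n ∈ testTriples)
    (h1 : CauchySeq fun n => (y n).2.1) (h2 : CauchySeq fun n => (y n).2.2) : CauchySeq y := by
  obtain ⟨K, hK⟩ := exists_norm_fst_le
  have d1 := cauchySeq_iff_tendsto_dist_atTop_0.1 h1
  have d2 := cauchySeq_iff_tendsto_dist_atTop_0.1 h2
  have h0 : CauchySeq fun n => (y n).1 := by
    rw [cauchySeq_iff_tendsto_dist_atTop_0]
    refine squeeze_zero (fun _ => dist_nonneg) (fun n => ?_)
      (by simpa using (d1.add d2).const_mul (K : ℝ))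
    simpa [dist_eq_norm] using hK _ (testTriples.sub_mem (hy n.1) (hy n.2))
  exact h0.prodMk (h1.prodMk h2)

/-! ### `H¹₀` as the closure of the test triples. -/

/-- The triple `x` consists of the function `u` and of its weak partial derivatives. -/
structure Represents (x : Triple) (u : ℝ × ℝ → ℝ) : Prop where
  ae_eq : u =ᵐ[mu] x.1
  isWeakDeriv_ex : IsWeakDeriv ex u x.2.1
  isWeakDeriv_ey : IsWeakDeriv ey u x.2.2

namespace Represents

variable {x y : Triple} {u v : ℝ × ℝ → ℝ}

theorem memLp_four (h : Represents x u) : MemLp u 4 mu := (memLp_congr_ae h.ae_eq).2 (Lp.memLp x.1)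

theorem memLp_two (h : Represents x u) : MemLp u 2 mu := h.memLp_four.mono_exponent (by norm_num)

theorem memH1 (h : Represents x u) : MemH1 u :=
  ⟨h.memLp_two, ⟨_, h.isWeakDeriv_ex⟩, ⟨_, h.isWeakDeriv_ey⟩⟩

theorem congr (h : Represents x u) (huv : u =ᵐ[mu] v) : Represents x v :=
  ⟨huv.symm.trans h.ae_eq, h.isWeakDeriv_ex.congr huv .rfl, h.isWeakDeriv_ey.congr huv .rfl⟩

theorem add (h : Represents x u) (h' : Represents y v) :
    Represents (x + y) fun z => u z + v z :=
  ⟨(h.ae_eq.add h'.ae_eq).trans (Lp.coeFn_add x.1 y.1).symm,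
    (h.isWeakDeriv_ex.add h.memLp_two h'.memLp_two h'.isWeakDeriv_ex).congr .rfl
      (Lp.coeFn_add x.2.1 y.2.1).symm,
    (h.isWeakDeriv_ey.add h.memLp_two h'.memLp_two h'.isWeakDeriv_ey).congr .rfl
      (Lp.coeFn_add x.2.2 y.2.2).symm⟩

theorem const_mul (h : Represents x u) (c : ℝ) : Represents (c • x) fun z => c * u z :=
  ⟨(h.ae_eq.const_smul c).trans (Lp.coeFn_smul c x.1).symm,
    (h.isWeakDeriv_ex.const_mul c).congr .rfl (Lp.coeFn_smul c x.2.1).symm,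
    (h.isWeakDeriv_ey.const_mul c).congr .rfl (Lp.coeFn_smul c x.2.2).symm⟩

end Represents

theorem represents_of_memLp {u g k : ℝ × ℝ → ℝ} (hu : MemLp u 4 mu) (hg : IsWeakDeriv ex u g)
    (hk : IsWeakDeriv ey u k) : Represents (hu.toLp u, hg.1.toLp g, hk.1.toLp k) u :=
  ⟨hu.coeFn_toLp.symm, hg.congr .rfl hg.1.coeFn_toLp.symm, hk.congr .rfl hk.1.coeFn_toLp.symm⟩

theorem IsTest.represents {φ : ℝ × ℝ → ℝ} (hφ : IsTest φ) : Represents hφ.triple φ :=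
  represents_of_memLp (hφ.memLp 4) (hφ.isWeakDeriv ex) (hφ.isWeakDeriv ey)

/-- Each test function imposes an equation between continuous functionals of `(u, g)`. Weak
differentiability is thus a closed condition, and it survives passage to the closure of the test
triples. -/
theorem isWeakDeriv_iff_inner (v : ℝ × ℝ) (u g : Lp ℝ 2 mu) :
    IsWeakDeriv v u g ↔ ∀ (φ : ℝ × ℝ → ℝ) (hφ : IsTest φ),
      inner ℝ ((hφ.memLp_fderiv v 2).toLp _) u = -inner ℝ ((hφ.memLp 2).toLp φ) g := by
  refine (and_iff_right (Lp.memLp g)).trans (forall_congr' fun φ => forall_congr' fun hφ => ?_)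
  have h : ∀ {f : ℝ × ℝ → ℝ} (hf : MemLp f 2 mu) (w : Lp ℝ 2 mu),
      ∫ z, w z * f z ∂mu = inner ℝ (hf.toLp f) w := fun {f} hf w => by
    rw [L2.inner_def]
    refine integral_congr_ae ?_
    filter_upwards [hf.coeFn_toLp] with z hz
    rw [hz, real_inner_eq_re_inner]
    rfl
  rw [h (hφ.memLp_fderiv v 2), h (hφ.memLp 2)]

theorem isClosed_isWeakDeriv (v : ℝ × ℝ) :
    IsClosed {q : Lp ℝ 2 mu × Lp ℝ 2 mu | IsWeakDeriv v q.1 q.2} := by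
  simp_rw [isWeakDeriv_iff_inner, ofPred_forall]
  refine isClosed_iInter fun φ => isClosed_iInter fun hφ => isClosed_eq ?_ ?_ <;> fun_prop

theorem represents_of_mem_closure {x : Triple} (hx : x ∈ closure (testTriples : Set Triple)) :
    Represents x x.1 := by
  have h : ∀ y ∈ (testTriples : Set Triple), IsWeakDeriv ex (inc y.1) y.2.1 ∧
      IsWeakDeriv ey (inc y.1) y.2.2 := by
    rintro _ ⟨φ, hφ, rfl⟩
    have := hφ.represents
    exact ⟨this.isWeakDeriv_ex.congr this.ae_eq .rfl, this.isWeakDeriv_ey.congr this.ae_eq .rfl⟩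
  have hc : IsClosed {y : Triple | IsWeakDeriv ex (inc y.1) y.2.1 ∧
      IsWeakDeriv ey (inc y.1) y.2.2} :=
    ((isClosed_isWeakDeriv ex).preimage
      (f := fun y : Triple => (inc y.1, y.2.1)) (by fun_prop)).inter
    ((isClosed_isWeakDeriv ey).preimage
      (f := fun y : Triple => (inc y.1, y.2.2)) (by fun_prop))
  have := closure_minimal h hc hx
  exact ⟨.rfl, this.1, this.2⟩

theorem eLpNorm_sub_eq {p : ℝ≥0∞} {f u : ℝ × ℝ → ℝ} (hf : MemLp f p mu) {w : Lp ℝ p mu}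
    (hu : u =ᵐ[mu] w) :
    eLpNorm (fun z => u z - f z) p mu = ENNReal.ofReal ‖w - hf.toLp f‖ := by
  rw [Lp.norm_def, ENNReal.ofReal_toReal (Lp.eLpNorm_ne_top _)]
  refine eLpNorm_congr_ae ?_
  filter_upwards [hu, hf.coeFn_toLp, Lp.coeFn_sub w (hf.toLp f)] with z h1 h2 h3
  rw [h3, Pi.sub_apply, h1, h2]

theorem Represents.memH10 {x : Triple} {u : ℝ × ℝ → ℝ} (h : Represents x u)
    (hx : x ∈ closure (testTriples : Set Triple)) : MemH10 u := by
  refine ⟨h.memH1, fun δ hδ => ?_⟩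
  -- One tolerance serves all three norms: the function is compared in `L²`, at the cost of a factor
  -- `‖inc‖`, and the added 1 handles the derivatives.
  obtain ⟨_, ⟨φ, hφ, rfl⟩, hd⟩ := Metric.mem_closure_iff.1 hx (δ / (‖inc‖ + 1)) (by positivity)
  rw [lt_div_iff₀ (by positivity), dist_eq_norm] at hd
  refine ⟨φ, hφ, ?_, ?_, ?_⟩
  · rw [eLpNorm_sub_eq (hφ.memLp 2) (w := inc x.1) h.ae_eq, ENNReal.ofReal_lt_ofReal_iff hδ,
      ← hφ.inc_triple, ← map_sub]
    have := inc.le_opNorm (x.1 - hφ.triple.1)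
    have h1 : ‖x.1 - hφ.triple.1‖ ≤ ‖x - hφ.triple‖ := norm_fst_le (x - hφ.triple)
    nlinarith [norm_nonneg inc, norm_nonneg (x - hφ.triple)]
  · rw [eLpNorm_sub_eq (hφ.memLp_fderiv ex 2) h.isWeakDeriv_ex.weakDeriv_ae_eq,
      ENNReal.ofReal_lt_ofReal_iff hδ]
    have h1 : ‖x.2.1 - hφ.triple.2.1‖ ≤ ‖x - hφ.triple‖ :=
      (norm_fst_le (x - hφ.triple).2).trans (norm_snd_le _)
    refine h1.trans_lt ?_
    nlinarith [norm_nonneg inc, norm_nonneg (x - hφ.triple)]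
  · rw [eLpNorm_sub_eq (hφ.memLp_fderiv ey 2) h.isWeakDeriv_ey.weakDeriv_ae_eq,
      ENNReal.ofReal_lt_ofReal_iff hδ]
    have h1 : ‖x.2.2 - hφ.triple.2.2‖ ≤ ‖x - hφ.triple‖ :=
      (norm_snd_le (x - hφ.triple).2).trans (norm_snd_le _)
    refine h1.trans_lt ?_
    nlinarith [norm_nonneg inc, norm_nonneg (x - hφ.triple)]

/-- A member of `H¹₀` belongs to `L⁴`, and is approximated there by the same test functions. -/
theorem MemH10.exists_represents {u : ℝ × ℝ → ℝ} (hu : MemH10 u) :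
    ∃ x ∈ closure (testTriples : Set Triple), Represents x u := by
  choose φ hφ h0 h1 h2 using fun n : ℕ => hu.2 (1 / (n + 1)) (by positivity)
  have hw := hu.1.isWeakDeriv
  have hlim : ∀ {f : ℕ → ℝ × ℝ → ℝ} {v : ℝ × ℝ → ℝ} (hf : ∀ n, MemLp (f n) 2 mu)
      (hv : MemLp v 2 mu), (∀ n : ℕ, eLpNorm (fun z => v z - f n z) 2 mu <
        ENNReal.ofReal (1 / (n + 1))) →
      Tendsto (fun n => (hf n).toLp (f n)) atTop (𝓝 (hv.toLp v)) := by
    intro f v hf hv h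
    rw [tendsto_iff_dist_tendsto_zero]
    refine squeeze_zero (fun _ => dist_nonneg) (fun n => ?_)
      tendsto_one_div_add_atTop_nhds_zero_nat
    have hn := h n
    rw [eLpNorm_sub_eq (hf n) hv.coeFn_toLp.symm,
      ENNReal.ofReal_lt_ofReal_iff (by positivity)] at hn
    rw [dist_comm, dist_eq_norm]
    exact hn.le
  have t0 := hlim (fun n => (hφ n).memLp 2) hu.1.1 h0
  have t1 := hlim (fun n => (hφ n).memLp_fderiv ex 2) hw.1.1 h1
  have t2 := hlim (fun n => (hφ n).memLp_fderiv ey 2) hw.2.1 h2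
  have hy : ∀ n, (hφ n).triple ∈ testTriples := fun n => ⟨_, hφ n, rfl⟩
  obtain ⟨x, hx⟩ := cauchySeq_tendsto_of_complete
    (cauchySeq_of_mem_testTriples hy t1.cauchySeq t2.cauchySeq)
  have hxm : x ∈ closure (testTriples : Set Triple) :=
    mem_closure_of_tendsto hx (Eventually.of_forall hy)
  -- The `L⁴` limit produced by the Sobolev inequality is identified with `u` by uniqueness of
  -- limits in `L²`.
  have e0 : inc x.1 = hu.1.1.toLp u :=
    tendsto_nhds_unique ((inc.continuous.tendsto _).comp
      ((continuous_fst.tendsto x).comp hx)) t0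
  refine ⟨x, hxm, (represents_of_mem_closure hxm).congr ?_⟩
  rw [← coe_inc, e0]
  exact hu.1.1.coeFn_toLp

/-! ### The direct method for the scalar energy. -/

/-- The Dirichlet part of the scalar energy. -/
def dirichletPart (b : ℝ) (x : Triple) : ℝ := 1 / b ^ 2 * ‖x.2.1‖ ^ 2 + ‖x.2.2‖ ^ 2

/-- The scalar energy as a function of the triple `(p, p_x, p_y)`. -/
def tripleEnergy (B C b lam : ℝ) (x : Triple) : ℝ :=
  dirichletPart b x + lam ^ 2 / (2 * C) * (-(B ^ 2 / (2 * C)) * ‖inc x.1‖ ^ 2 + C * ‖x.1‖ ^ 4)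

theorem continuous_tripleEnergy (B C b lam : ℝ) : Continuous (tripleEnergy B C b lam) := by
  unfold tripleEnergy dirichletPart
  fun_prop

theorem norm_midpoint_sq {E : Type*} [NormedAddCommGroup E] [InnerProductSpace ℝ E] (x y : E) :
    ‖(1 / 2 : ℝ) • (x + y)‖ ^ 2 = 1 / 2 * ‖x‖ ^ 2 + 1 / 2 * ‖y‖ ^ 2 - 1 / 4 * ‖x - y‖ ^ 2 := by
  have := parallelogram_law_with_norm ℝ x y
  rw [norm_smul, mul_pow]
  norm_num
  nlinarith

theorem norm_midpoint_pow_four_le {E : Type*} [NormedAddCommGroup E] [NormedSpace ℝ E] (x y : E) :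
    ‖(1 / 2 : ℝ) • (x + y)‖ ^ 4 ≤ 1 / 2 * ‖x‖ ^ 4 + 1 / 2 * ‖y‖ ^ 4 := by
  have h : ‖(1 / 2 : ℝ) • (x + y)‖ ≤ 1 / 2 * (‖x‖ + ‖y‖) := by
    rw [norm_smul]
    norm_num
    exact norm_add_le x y
  calc _ ≤ (1 / 2 * (‖x‖ + ‖y‖)) ^ 4 := by gcongr
    _ ≤ _ := by
      have a := sq_nonneg (‖x‖ - ‖y‖)
      have b := sq_nonneg (‖x‖ ^ 2 - ‖y‖ ^ 2)
      nlinarith [mul_nonneg a (sq_nonneg (‖x‖ + ‖y‖)), mul_nonneg a (sq_nonneg ‖x‖),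
        mul_nonneg a (sq_nonneg ‖y‖)]

/-- The parallelogram identity turns the gradient terms into the left-hand side, the quartic term is
convex and can be dropped, and the concave quadratic term leaves precisely the `L²` distance. -/
theorem dirichletPart_sub_le {B C b lam : ℝ} (hC : 0 < C) (x y : Triple) :
    dirichletPart b (x - y) ≤ 2 * tripleEnergy B C b lam x + 2 * tripleEnergy B C b lam y
      - 4 * tripleEnergy B C b lam ((1 / 2 : ℝ) • (x + y))
      + lam ^ 2 / (2 * C) * (B ^ 2 / (2 * C)) * ‖inc x.1 - inc y.1‖ ^ 2 := by
  have h4 := norm_midpoint_pow_four_le x.1 y.1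
  have h4' := mul_le_mul_of_nonneg_left h4
    (show 0 ≤ lam ^ 2 / (2 * C) * C by positivity)
  unfold tripleEnergy dirichletPart
  simp only [Prod.smul_fst, Prod.smul_snd, Prod.fst_add, Prod.snd_add, Prod.fst_sub, Prod.snd_sub,
    map_smul, map_add, norm_midpoint_sq]
  nlinarith

/-- With `a = B ^ 2 / (2 * C) * ‖inc‖ ^ 2`, the potential part is at least `C * s ^ 2 - a * s` for
`s = ‖x.1‖ ^ 2`, whose minimum is `-a ^ 2 / (4 * C)`. -/
theorem exists_dirichletPart_le (B : ℝ) {C : ℝ} (hC : 0 < C) (b lam : ℝ) :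
    ∃ κ : ℝ, ∀ x, dirichletPart b x ≤ tripleEnergy B C b lam x + κ := by
  refine ⟨lam ^ 2 / (2 * C) * ((B ^ 2 / (2 * C) * ‖inc‖ ^ 2) ^ 2 / (4 * C)), fun x => ?_⟩
  have h1 : ‖inc x.1‖ ^ 2 ≤ ‖inc‖ ^ 2 * ‖x.1‖ ^ 2 := by
    rw [← mul_pow]
    gcongr
    exact inc.le_opNorm _
  have h2 : 0 ≤ -(B ^ 2 / (2 * C)) * ‖inc x.1‖ ^ 2 + C * ‖x.1‖ ^ 4 +
      (B ^ 2 / (2 * C) * ‖inc‖ ^ 2) ^ 2 / (4 * C) := by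
    have h3 : B ^ 2 / (2 * C) * ‖inc x.1‖ ^ 2 ≤ B ^ 2 / (2 * C) * ‖inc‖ ^ 2 * ‖x.1‖ ^ 2 := by
      rw [mul_assoc]
      gcongr
    set a := B ^ 2 / (2 * C) * ‖inc‖ ^ 2
    have h4 : 0 ≤ C * (‖x.1‖ ^ 2 - a / (2 * C)) ^ 2 := by positivity
    have h5 : C * (‖x.1‖ ^ 2 - a / (2 * C)) ^ 2 =
        C * ‖x.1‖ ^ 4 - a * ‖x.1‖ ^ 2 + a ^ 2 / (4 * C) := by
      field_simp
      ring
    linarith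
  have h3 := mul_nonneg (show 0 ≤ lam ^ 2 / (2 * C) by positivity) h2
  unfold tripleEnergy
  linarith

theorem norm_sq_le_of_dirichletPart {b : ℝ} (hb : 1 ≤ b) (x : Triple) :
    ‖x.2.1‖ ^ 2 ≤ b ^ 2 * dirichletPart b x ∧ ‖x.2.2‖ ^ 2 ≤ b ^ 2 * dirichletPart b x := by
  have e : b ^ 2 * dirichletPart b x = ‖x.2.1‖ ^ 2 + b ^ 2 * ‖x.2.2‖ ^ 2 := by
    unfold dirichletPart
    field_simp
  rw [e]
  have : 1 ≤ b ^ 2 := by nlinarith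
  constructor <;> nlinarith [sq_nonneg ‖x.2.1‖, sq_nonneg ‖x.2.2‖]

theorem dirichletPart_nonneg (b : ℝ) (x : Triple) : 0 ≤ dirichletPart b x := by
  unfold dirichletPart
  positivity

/-- Coercivity: the energy bounds the gradient of `e + y`, hence that of `y`, and the Sobolev
inequality bounds `y` itself. -/
theorem exists_norm_le_of_tripleEnergy_le (B : ℝ) {C b : ℝ} (hC : 0 < C) (hb : 1 ≤ b) (lam : ℝ)
    (e : Triple) (A : ℝ) : ∃ M : ℝ, ∀ y ∈ testTriples,
      tripleEnergy B C b lam (e + y) ≤ A → ‖y‖ ≤ M := by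
  obtain ⟨κ, hκ⟩ := exists_dirichletPart_le B hC b lam
  obtain ⟨K, hK⟩ := exists_norm_fst_le
  set R := Real.sqrt (b ^ 2 * (A + κ)) + ‖e‖
  refine ⟨max (K * (R + R)) R, fun y hy hA => ?_⟩
  have h1 := norm_sq_le_of_dirichletPart hb (e + y)
  have h2 : b ^ 2 * dirichletPart b (e + y) ≤ b ^ 2 * (A + κ) :=
    mul_le_mul_of_nonneg_left ((hκ (e + y)).trans (by linarith)) (sq_nonneg b)
  have hR : ∀ {u w : Lp ℝ 2 mu}, ‖u + w‖ ^ 2 ≤ b ^ 2 * dirichletPart b (e + y) → ‖u‖ ≤ ‖e‖ →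
      ‖w‖ ≤ R := fun {u w} h hu => by
    have h3 := Real.le_sqrt_of_sq_le (h.trans h2)
    have h4 := norm_sub_le (u + w) u
    rw [add_sub_cancel_left] at h4
    linarith
  have hR1 : ‖y.2.1‖ ≤ R := hR h1.1 ((norm_fst_le e.2).trans (norm_snd_le e))
  have hR2 : ‖y.2.2‖ ≤ R := hR h1.2 ((norm_snd_le e.2).trans (norm_snd_le e))
  have h3 : (K : ℝ) * (‖y.2.1‖ + ‖y.2.2‖) ≤ K * (R + R) :=
    mul_le_mul_of_nonneg_left (add_le_add hR1 hR2) K.2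
  rw [Prod.norm_def, Prod.norm_def (x := y.2)]
  exact max_le_max ((hK y hy).trans h3) (max_le hR1 hR2)

/-- The midpoint of two test triples is again a test triple, so its energy is at least `m`. -/
theorem dirichletPart_sub_le_of_le {B C b lam : ℝ} (hC : 0 < C) {e : Triple} {m : ℝ}
    (hm : ∀ y ∈ testTriples, m ≤ tripleEnergy B C b lam (e + y)) {x y : Triple}
    (hx : x ∈ testTriples) (hy : y ∈ testTriples) :
    dirichletPart b (x - y) ≤ 2 * (tripleEnergy B C b lam (e + x) - m) +
      2 * (tripleEnergy B C b lam (e + y) - m) +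
      lam ^ 2 / (2 * C) * (B ^ 2 / (2 * C)) * dist (inc x.1) (inc y.1) ^ 2 := by
  have h1 := dirichletPart_sub_le (B := B) (b := b) (lam := lam) hC (e + x) (e + y)
  have h2 := hm _ (testTriples.smul_mem (1 / 2 : ℝ) (testTriples.add_mem hx hy))
  have h3 : (1 / 2 : ℝ) • (e + x + (e + y)) = e + (1 / 2 : ℝ) • (x + y) := by module
  rw [add_sub_add_left_eq_sub, h3, Prod.fst_add, Prod.fst_add, map_add, map_add,
    add_sub_add_left_eq_sub, ← dist_eq_norm] at h1
  linarith

/-- A minimizing sequence that is Cauchy in `L²` is Cauchy in `H¹`. -/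
theorem cauchySeq_of_minimizing {B C b lam : ℝ} (hC : 0 < C) (hb : 1 ≤ b) {e : Triple} {m : ℝ}
    (hm : ∀ y ∈ testTriples, m ≤ tripleEnergy B C b lam (e + y)) {y : ℕ → Triple}
    (hy : ∀ n, y n ∈ testTriples)
    (hF : Tendsto (fun n => tripleEnergy B C b lam (e + y n)) atTop (𝓝 m))
    (hw : CauchySeq fun n => inc (y n).1) : CauchySeq y := by
  set F : ℕ → ℝ := fun n => tripleEnergy B C b lam (e + y n) with hFdef
  have hF' : Tendsto (fun n => F n - m) atTop (𝓝 0) := by simpa using hF.sub_const m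
  have hsq : Tendsto (fun n : ℕ × ℕ => b ^ 2 * (2 * (F n.1 - m) + 2 * (F n.2 - m) +
      lam ^ 2 / (2 * C) * (B ^ 2 / (2 * C)) * dist (inc (y n.1).1) (inc (y n.2).1) ^ 2))
      atTop (𝓝 0) := by
    have h1 : Tendsto (fun n : ℕ × ℕ => F n.1 - m) atTop (𝓝 0) := by
      rw [← prod_atTop_atTop_eq]
      exact hF'.comp tendsto_fst
    have h2 : Tendsto (fun n : ℕ × ℕ => F n.2 - m) atTop (𝓝 0) := by
      rw [← prod_atTop_atTop_eq]
      exact hF'.comp tendsto_snd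
    have h3 := cauchySeq_iff_tendsto_dist_atTop_0.1 hw
    simpa using (((h1.const_mul 2).add (h2.const_mul 2)).add ((h3.pow 2).const_mul
      (lam ^ 2 / (2 * C) * (B ^ 2 / (2 * C))))).const_mul (b ^ 2)
  have hcau : ∀ {u : ℕ → Lp ℝ 2 mu}, (∀ n : ℕ × ℕ, ‖u n.1 - u n.2‖ ^ 2 ≤
      b ^ 2 * dirichletPart b (y n.1 - y n.2)) → CauchySeq u := by
    intro u hu
    rw [cauchySeq_iff_tendsto_dist_atTop_0]
    refine squeeze_zero (fun _ => dist_nonneg) (fun n => ?_) (by simpa using hsq.sqrt)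
    rw [dist_eq_norm]
    refine Real.le_sqrt_of_sq_le ((hu n).trans ?_)
    exact mul_le_mul_of_nonneg_left (dirichletPart_sub_le_of_le hC hm (hy n.1) (hy n.2))
      (sq_nonneg b)
  exact cauchySeq_of_mem_testTriples hy
    (hcau fun n => (norm_sq_le_of_dirichletPart hb (y n.1 - y n.2)).1)
    (hcau fun n => (norm_sq_le_of_dirichletPart hb (y n.1 - y n.2)).2)

/-- The direct method: the energy attains its minimum on each translate of `H¹₀`. -/
theorem exists_isMin_tripleEnergy (B : ℝ) {C b : ℝ} (hC : 0 < C) (hb : 1 ≤ b) (lam : ℝ)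
    (e : Triple) : ∃ x ∈ closure (testTriples : Set Triple),
      ∀ y ∈ closure (testTriples : Set Triple),
        tripleEnergy B C b lam (e + x) ≤ tripleEnergy B C b lam (e + y) := by
  obtain ⟨F, hF⟩ : ∃ F : Triple → ℝ, F = fun y => tripleEnergy B C b lam (e + y) := ⟨_, rfl⟩
  have hFe : ∀ y, tripleEnergy B C b lam (e + y) = F y := fun y => by rw [hF]
  have hFc : Continuous F := by
    rw [hF]
    exact (continuous_tripleEnergy B C b lam).comp (continuous_const_add e)
  obtain ⟨κ, hκ⟩ := exists_dirichletPart_le B hC b lam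
  -- The infimum is taken over test triples only, where the Sobolev and Rellich estimates are
  -- available; continuity of `F` extends the lower bound to the closure at the end.
  have hbdd : BddBelow (F '' testTriples) := ⟨-κ, by
    rintro _ ⟨y, -, rfl⟩
    linarith [hκ (e + y), hFe y, dirichletPart_nonneg b (e + y)]⟩
  set m := sInf (F '' testTriples)
  have hm : ∀ y ∈ testTriples, m ≤ F y := fun y hy => csInf_le hbdd (mem_image_of_mem F hy)
  obtain ⟨f, -, hf, hfm⟩ := exists_seq_tendsto_sInf
    (show (F '' testTriples).Nonempty from ⟨_, 0, testTriples.zero_mem, rfl⟩) hbdd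
  choose y hy hyf using hfm
  have hFy : Tendsto (fun n => F (y n)) atTop (𝓝 m) := by simpa only [hyf] using hf
  obtain ⟨A, hA⟩ := hFy.bddAbove_range
  obtain ⟨M, hM⟩ := exists_norm_le_of_tripleEnergy_le B hC hb lam e A
  simp only [hFe] at hM ⊢
  -- Compactness is used only for convergence in `L²`; `cauchySeq_of_minimizing` upgrades it to norm
  -- convergence of triples.
  have hcomp := ((totallyBounded_inc_image M).closure).isCompact_of_isClosed isClosed_closure
  obtain ⟨w, -, σ, hσ, hw⟩ := hcomp.tendsto_subseq (x := fun n => inc (y n).1) fun n =>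
    subset_closure ⟨y n, ⟨hy n, hM (y n) (hy n) (hA (mem_range_self n))⟩, rfl⟩
  have hFσ : Tendsto (fun n => F (y (σ n))) atTop (𝓝 m) := hFy.comp hσ.tendsto_atTop
  obtain ⟨x, hx⟩ := cauchySeq_tendsto_of_complete (cauchySeq_of_minimizing (B := B) (C := C)
    (b := b) (lam := lam) (e := e) (m := m) (y := fun n => y (σ n)) hC hb
    (by simpa only [hFe] using hm) (fun n => hy (σ n)) (by simpa only [hFe] using hFσ)
    hw.cauchySeq)
  refine ⟨x, mem_closure_of_tendsto hx (Eventually.of_forall fun n => hy (σ n)), fun z hz => ?_⟩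
  have hFx : F x = m := tendsto_nhds_unique ((hFc.tendsto x).comp hx) hFσ
  have hcl : m ≤ F z := closure_minimal (t := {z | m ≤ F z}) (fun z hz => hm z hz)
    (isClosed_le continuous_const hFc) hz
  exact hFx.trans_le hcl

/-! ### From triples back to functions: existence of a scalar minimizer. -/

theorem Represents.zero : Represents 0 fun _ => 0 :=
  ⟨(Lp.coeFn_zero ℝ 4 mu).symm, IsWeakDeriv.zero.congr .rfl (Lp.coeFn_zero ℝ 2 mu).symm,
    IsWeakDeriv.zero.congr .rfl (Lp.coeFn_zero ℝ 2 mu).symm⟩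

theorem MemH10.const_mul {u : ℝ × ℝ → ℝ} (hu : MemH10 u) (c : ℝ) : MemH10 fun z => c * u z := by
  obtain ⟨x, hx, h⟩ := hu.exists_represents
  exact (h.const_mul c).memH10 (testTriples.topologicalClosure.smul_mem c hx)

theorem MemH10.zero : MemH10 fun _ => 0 :=
  Represents.zero.memH10 testTriples.topologicalClosure.zero_mem

theorem MemH10.congr {u v : ℝ × ℝ → ℝ} (hu : MemH10 u) (h : ∀ z, u z = v z) : MemH10 v :=
  (funext h : u = v) ▸ hu

theorem MemH10.add {u v : ℝ × ℝ → ℝ} (hu : MemH10 u) (hv : MemH10 v) :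
    MemH10 fun z => u z + v z := by
  obtain ⟨x, hx, h⟩ := hu.exists_represents
  obtain ⟨y, hy, h'⟩ := hv.exists_represents
  exact (h.add h').memH10 (testTriples.topologicalClosure.add_mem hx hy)

theorem exists_represents_bc11 (B C : ℝ) {ε : ℝ} (h0 : 0 < ε) (h1 : ε < 1 / 2) :
    ∃ e, Represents e (bc11 B C ε) := by
  obtain ⟨K, hK⟩ := lipschitz_bc11 B C h0 h1
  exact ⟨_, represents_of_memLp (hK.memLp_mu 4) (hK.isWeakDeriv_lineDeriv ex)
    (hK.isWeakDeriv_lineDeriv ey)⟩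

theorem scalarAdmissible_of_represents {B C ε : ℝ} {e x : Triple} {q : ℝ × ℝ → ℝ}
    (he : Represents e (bc11 B C ε)) (hx : x ∈ closure (testTriples : Set Triple))
    (hq : Represents (e + x) q) : ScalarAdmissible B C ε q := by
  have h : Represents x fun z => q z - bc11 B C ε z := by
    have := hq.add (he.const_mul (-1))
    rw [show e + x + (-1 : ℝ) • e = x by module] at this
    exact this.congr (ae_of_all _ fun z => by ring)
  exact ⟨hq.memH1, h.memH10 hx⟩

theorem ScalarAdmissible.exists_represents {B C ε : ℝ} {e : Triple} {q : ℝ × ℝ → ℝ}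
    (he : Represents e (bc11 B C ε)) (hq : ScalarAdmissible B C ε q) :
    ∃ x ∈ closure (testTriples : Set Triple), Represents (e + x) q := by
  obtain ⟨x, hx, h⟩ := hq.2.exists_represents
  exact ⟨x, hx, (he.add h).congr (ae_of_all _ fun z => by ring)⟩

theorem integrable_pow_and_integral {p : ℝ≥0∞} [Fact (1 ≤ p)] {n : ℕ} (hn : n ≠ 0) (he : Even n)
    (hp : p = n) (f : Lp ℝ p mu) :
    Integrable (fun z => f z ^ n) mu ∧ ∫ z, f z ^ n ∂mu = ‖f‖ ^ n := by
  subst hp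
  have e : ∀ z, ‖f z‖ ^ n = f z ^ n := fun z => by rw [Real.norm_eq_abs, he.pow_abs]
  have hf := Lp.memLp f
  constructor
  · simpa only [e] using hf.integrable_norm_pow hn
  · have h := hf.eLpNorm_eq_integral_rpow_norm (by exact_mod_cast hn) (ENNReal.natCast_ne_top n)
    have h0 : 0 ≤ ∫ z, f z ^ n ∂mu := integral_nonneg fun z => he.pow_nonneg _
    simp only [ENNReal.toReal_natCast, Real.rpow_natCast, e] at h
    rw [Lp.norm_def, h, ENNReal.toReal_ofReal (by positivity), ← Real.rpow_natCast,
      ← Real.rpow_mul h0, inv_mul_cancel₀ (by exact_mod_cast hn), Real.rpow_one]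

theorem Represents.scalarDensity_ae_eq (B C b lam : ℝ) {x : Triple} {u : ℝ × ℝ → ℝ}
    (h : Represents x u) : scalarDensity B C b lam u =ᵐ[mu] fun z =>
      1 / b ^ 2 * x.2.1 z ^ 2 + x.2.2 z ^ 2 +
        lam ^ 2 / (2 * C) * (-(B ^ 2 / (2 * C)) * x.1 z ^ 2 + C * x.1 z ^ 4) := by
  filter_upwards [h.ae_eq, h.isWeakDeriv_ex.weakDeriv_ae_eq, h.isWeakDeriv_ey.weakDeriv_ae_eq]
    with z h1 h2 h3
  rw [scalarDensity, h1, h2, h3]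

theorem Represents.integrable_and_scalarEnergy_eq (B C b lam : ℝ) {x : Triple} {u : ℝ × ℝ → ℝ}
    (h : Represents x u) : Integrable (scalarDensity B C b lam u) mu ∧
      scalarEnergy B C b lam u = tripleEnergy B C b lam x := by
  have h1 := integrable_pow_and_integral two_ne_zero even_two (by norm_num) x.2.1
  have h2 := integrable_pow_and_integral two_ne_zero even_two (by norm_num) x.2.2
  have h3 := integrable_pow_and_integral two_ne_zero even_two (by norm_num) (inc x.1)
  have h4 := integrable_pow_and_integral (n := 4) (by norm_num) (by decide) (by norm_num) x.1
  rw [coe_inc] at h3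
  have hae := h.scalarDensity_ae_eq B C b lam
  have i1 := (h1.1.const_mul (1 / b ^ 2)).fun_add h2.1
  have i2 := (h3.1.const_mul (-(B ^ 2 / (2 * C)))).fun_add (h4.1.const_mul C)
  refine ⟨(integrable_congr hae).2 (i1.add (i2.const_mul (lam ^ 2 / (2 * C)))), ?_⟩
  rw [scalarEnergy, integral_congr_ae hae, integral_add i1 (i2.const_mul (lam ^ 2 / (2 * C))),
    integral_const_mul, integral_add (h1.1.const_mul (1 / b ^ 2)) h2.1, integral_const_mul,
    integral_add (h3.1.const_mul (-(B ^ 2 / (2 * C)))) (h4.1.const_mul C),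
    integral_const_mul, integral_const_mul, h1.2, h2.2, h3.2, h4.2]
  rfl

theorem exists_isScalarMinimizer (B : ℝ) {C b ε : ℝ} (hC : 0 < C) (hb : 1 ≤ b) (lam : ℝ)
    (h0 : 0 < ε) (h1 : ε < 1 / 2) : ∃ p, IsScalarMinimizer B C b lam ε p := by
  obtain ⟨e, he⟩ := exists_represents_bc11 B C h0 h1
  obtain ⟨x, hx, hmin⟩ := exists_isMin_tripleEnergy B hC hb lam e
  have hp := he.add (represents_of_mem_closure hx)
  refine ⟨_, scalarAdmissible_of_represents he hx hp, fun q hq => ?_⟩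
  obtain ⟨y, hy, hqy⟩ := hq.exists_represents he
  obtain ⟨i, eq⟩ := hqy.integrable_and_scalarEnergy_eq B C b lam
  refine ⟨i, ?_⟩
  rw [eq, (hp.integrable_and_scalarEnergy_eq B C b lam).2]
  exact hmin y hy

/-! ### First variation and critical points. -/

theorem hasDerivAt_quartic_zero (a₀ a₁ a₂ a₃ a₄ : ℝ) :
    HasDerivAt (fun t => a₀ + t * a₁ + t ^ 2 * a₂ + t ^ 3 * a₃ + t ^ 4 * a₄) a₁ 0 := by
  have h := (((((hasDerivAt_id (0 : ℝ)).mul_const a₁).const_add a₀).fun_add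
    ((hasDerivAt_pow 2 (0 : ℝ)).mul_const a₂)).fun_add
    ((hasDerivAt_pow 3 (0 : ℝ)).mul_const a₃)).fun_add
    ((hasDerivAt_pow 4 (0 : ℝ)).mul_const a₄)
  exact h.congr_deriv (by simp)

/-- Differentiation of the integral of a quartic polynomial in a parameter. -/
theorem hasDerivAt_integral_quartic {α : Type*} {m : MeasurableSpace α} {ν : Measure α}
    [IsFiniteMeasure ν] {r₀ r₁ r₂ q₀ q₁ q₂ : α → ℝ} (hr₀ : Integrable r₀ ν)
    (hr₁ : Integrable r₁ ν) (hr₂ : Integrable r₂ ν) (hq₀ : MemLp q₀ 2 ν) (hq₁ : MemLp q₁ 2 ν)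
    (hq₂ : MemLp q₂ 2 ν) (κ a c : ℝ) {D : ℝ → α → ℝ}
    (hD : ∀ t, D t =ᵐ[ν] fun z => r₀ z + t * r₁ z + t ^ 2 * r₂ z +
      κ * (-a * (q₀ z + t * q₁ z + t ^ 2 * q₂ z) + c * (q₀ z + t * q₁ z + t ^ 2 * q₂ z) ^ 2)) :
    (∀ t, Integrable (D t) ν) ∧ HasDerivAt (fun t => ∫ z, D t z ∂ν)
      (∫ z, (r₁ z + κ * (-a * q₁ z + 2 * c * (q₀ z * q₁ z))) ∂ν) 0 := by
  have j₀ := hq₀.integrable (by norm_num : (1 : ℝ≥0∞) ≤ 2)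
  have j₁ := hq₁.integrable (by norm_num : (1 : ℝ≥0∞) ≤ 2)
  have j₂ := hq₂.integrable (by norm_num : (1 : ℝ≥0∞) ≤ 2)
  have j₀₀ := hq₀.integrable_mul_two hq₀
  have j₀₁ := hq₀.integrable_mul_two hq₁
  have j₀₂ := hq₀.integrable_mul_two hq₂
  have j₁₁ := hq₁.integrable_mul_two hq₁
  have j₁₂ := hq₁.integrable_mul_two hq₂
  have j₂₂ := hq₂.integrable_mul_two hq₂
  have i₀ : Integrable (fun z => r₀ z + κ * (-a * q₀ z + c * (q₀ z * q₀ z))) ν :=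
    hr₀.add (((j₀.const_mul _).add (j₀₀.const_mul _)).const_mul _)
  have i₁ : Integrable (fun z => r₁ z + κ * (-a * q₁ z + 2 * c * (q₀ z * q₁ z))) ν :=
    hr₁.add (((j₁.const_mul _).add (j₀₁.const_mul _)).const_mul _)
  have i₂ : Integrable (fun z => r₂ z +
      κ * (-a * q₂ z + c * (q₁ z * q₁ z) + 2 * c * (q₀ z * q₂ z))) ν :=
    hr₂.add ((((j₂.const_mul _).add (j₁₁.const_mul _)).add (j₀₂.const_mul _)).const_mul _)
  have i₃ : Integrable (fun z => κ * (2 * c) * (q₁ z * q₂ z)) ν := j₁₂.const_mul _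
  have i₄ : Integrable (fun z => κ * c * (q₂ z * q₂ z)) ν := j₂₂.const_mul _
  obtain ⟨c₁, hc₁⟩ : ∃ c₁, c₁ = fun z => r₁ z + κ * (-a * q₁ z + 2 * c * (q₀ z * q₁ z)) :=
    ⟨_, rfl⟩
  rw [← hc₁] at i₁
  -- The integrand is a quartic in `t` with integrable coefficients, so the integral is itself a
  -- quartic in `t` and no exchange of limits is needed.
  have hD' : ∀ t, D t =ᵐ[ν] fun z => (r₀ z + κ * (-a * q₀ z + c * (q₀ z * q₀ z))) + t * c₁ z +
      t ^ 2 * (r₂ z + κ * (-a * q₂ z + c * (q₁ z * q₁ z) + 2 * c * (q₀ z * q₂ z))) +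
      t ^ 3 * (κ * (2 * c) * (q₁ z * q₂ z)) + t ^ 4 * (κ * c * (q₂ z * q₂ z)) := fun t => by
    filter_upwards [hD t] with z hz
    rw [hz, hc₁]
    ring
  have k₁ := fun t : ℝ => i₀.fun_add (i₁.const_mul t)
  have k₂ := fun t : ℝ => (k₁ t).fun_add (i₂.const_mul (t ^ 2))
  have k₃ := fun t : ℝ => (k₂ t).fun_add (i₃.const_mul (t ^ 3))
  have k₄ := fun t : ℝ => (k₃ t).fun_add (i₄.const_mul (t ^ 4))
  refine ⟨fun t => (integrable_congr (hD' t)).2 (k₄ t), ?_⟩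
  have hI : ∀ t, ∫ z, D t z ∂ν = (∫ z, (r₀ z + κ * (-a * q₀ z + c * (q₀ z * q₀ z))) ∂ν) +
      t * (∫ z, c₁ z ∂ν) + t ^ 2 * (∫ z, (r₂ z +
        κ * (-a * q₂ z + c * (q₁ z * q₁ z) + 2 * c * (q₀ z * q₂ z))) ∂ν) +
      t ^ 3 * (∫ z, κ * (2 * c) * (q₁ z * q₂ z) ∂ν) +
      t ^ 4 * (∫ z, κ * c * (q₂ z * q₂ z) ∂ν) := fun t => by
    rw [integral_congr_ae (hD' t), integral_add (k₃ t) (i₄.const_mul (t ^ 4)),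
      integral_add (k₂ t) (i₃.const_mul (t ^ 3)), integral_add (k₁ t) (i₂.const_mul (t ^ 2)),
      integral_add i₀ (i₁.const_mul t)]
    simp only [integral_const_mul]
  rw [funext hI, ← hc₁]
  exact hasDerivAt_quartic_zero _ _ _ _ _

theorem normSq_eq (M : Matrix (Fin 2) (Fin 2) ℝ) :
    normSq M = M 0 0 ^ 2 + 2 * (M 0 1 * M 1 0) + M 1 1 ^ 2 := by
  simp [normSq, Matrix.trace_fin_two, Matrix.mul_apply, Fin.sum_univ_two]
  ring

/-- The shared `y` and the `-x` encode symmetry and vanishing trace, so `|P|² = 2 (x² + y²)`. This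
factor 2 converts the coefficients of `E` into those of `H`. -/
theorem energyDensity_ae_eq (B C b lam : ℝ) {P : Field} {x y : Triple}
    (h00 : Represents x fun z => P z 0 0) (h01 : Represents y fun z => P z 0 1)
    (h10 : Represents y fun z => P z 1 0) (h11 : Represents ((-1 : ℝ) • x) fun z => P z 1 1) :
    energyDensity B C b lam P =ᵐ[mu] fun z =>
      1 / b ^ 2 * (x.2.1 z ^ 2 + y.2.1 z ^ 2) + (x.2.2 z ^ 2 + y.2.2 z ^ 2) +
        lam ^ 2 / (2 * C) * (-(B ^ 2 / (2 * C)) * (x.1 z ^ 2 + y.1 z ^ 2) +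
          C * (x.1 z ^ 2 + y.1 z ^ 2) ^ 2) := by
  filter_upwards [h00.ae_eq, h00.isWeakDeriv_ex.weakDeriv_ae_eq,
    h00.isWeakDeriv_ey.weakDeriv_ae_eq, h01.ae_eq, h01.isWeakDeriv_ex.weakDeriv_ae_eq,
    h01.isWeakDeriv_ey.weakDeriv_ae_eq, h10.ae_eq, h10.isWeakDeriv_ex.weakDeriv_ae_eq,
    h10.isWeakDeriv_ey.weakDeriv_ae_eq, h11.ae_eq, h11.isWeakDeriv_ex.weakDeriv_ae_eq,
    h11.isWeakDeriv_ey.weakDeriv_ae_eq, Lp.coeFn_smul (-1 : ℝ) x.1, Lp.coeFn_smul (-1 : ℝ) x.2.1,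
    Lp.coeFn_smul (-1 : ℝ) x.2.2] with z a1 a2 a3 b1 b2 b3 c1 c2 c3 d1 d2 d3 e1 e2 e3
  simp only [Prod.smul_fst, Prod.smul_snd] at d1 d2 d3
  rw [e1] at d1
  rw [e2] at d2
  rw [e3] at d3
  simp only [Pi.smul_apply, smul_eq_mul] at d1 d2 d3
  simp only [energyDensity, normSq_eq, weakDerivField, Matrix.of_apply]
  rw [a1, a2, a3, b1, b2, b3, c1, c2, c3, d1, d2, d3]
  field_simp
  ring

/-- Hölder's inequality; this is why functions are kept in `L⁴`, so that the coefficients of `|P +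
tV|²` lie in `L²` and the squared term is integrable. -/
theorem memLp_two_mul (u v : Lp ℝ 4 mu) : MemLp (fun z => u z * v z) 2 mu := by
  have : ENNReal.HolderTriple 4 4 2 := ⟨by
    rw [← two_mul, show (4 : ℝ≥0∞) = 2 * 2 by norm_num,
      ENNReal.mul_inv (by norm_num) (by norm_num), ← mul_assoc,
      ENNReal.mul_inv_cancel (by norm_num) (by norm_num), one_mul]⟩
  exact (Lp.memLp v).mul (Lp.memLp u)

theorem integrable_mul_Lp_two (u v : Lp ℝ 2 mu) : Integrable (fun z => u z * v z) mu :=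
  (Lp.memLp u).integrable_mul_two (Lp.memLp v)

/-- The first variation of the scalar energy. -/
def firstVariation (B C b lam : ℝ) (x y : Triple) : ℝ :=
  ∫ z, (1 / b ^ 2 * (2 * (x.2.1 z * y.2.1 z)) + 2 * (x.2.2 z * y.2.2 z) +
    lam ^ 2 / (2 * C) * (-(B ^ 2 / (2 * C)) * (2 * (x.1 z * y.1 z)) +
      2 * C * (x.1 z * x.1 z * (2 * (x.1 z * y.1 z))))) ∂mu

/-- The energy of the fields with first row `(p + t v, t w)` is finite, and its derivative at
`t = 0` does not depend on `w`. -/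
theorem hasDerivAt_energy_line {B C b lam : ℝ} {x y z : Triple} {D : ℝ → ℝ × ℝ → ℝ}
    (hD : ∀ t, D t =ᵐ[mu] fun s =>
      1 / b ^ 2 * ((x + t • y).2.1 s ^ 2 + (t • z).2.1 s ^ 2) +
        ((x + t • y).2.2 s ^ 2 + (t • z).2.2 s ^ 2) +
        lam ^ 2 / (2 * C) * (-(B ^ 2 / (2 * C)) * ((x + t • y).1 s ^ 2 + (t • z).1 s ^ 2) +
          C * ((x + t • y).1 s ^ 2 + (t • z).1 s ^ 2) ^ 2)) :
    (∀ t, Integrable (D t) mu) ∧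
      HasDerivAt (fun t => ∫ s, D t s ∂mu) (firstVariation B C b lam x y) 0 := by
  -- The off-diagonal component `z` occurs only in `r₂` and `q₂`, the coefficients of `t ^ 2`; the
  -- derivative involves only `r₁`, `q₀` and `q₁`.
  refine hasDerivAt_integral_quartic
    (r₀ := fun s => 1 / b ^ 2 * (x.2.1 s * x.2.1 s) + x.2.2 s * x.2.2 s)
    (r₁ := fun s => 1 / b ^ 2 * (2 * (x.2.1 s * y.2.1 s)) + 2 * (x.2.2 s * y.2.2 s))
    (r₂ := fun s => 1 / b ^ 2 * (y.2.1 s * y.2.1 s + z.2.1 s * z.2.1 s) +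
      (y.2.2 s * y.2.2 s + z.2.2 s * z.2.2 s))
    (q₀ := fun s => x.1 s * x.1 s) (q₁ := fun s => 2 * (x.1 s * y.1 s))
    (q₂ := fun s => y.1 s * y.1 s + z.1 s * z.1 s)
    (((integrable_mul_Lp_two _ _).const_mul _).fun_add (integrable_mul_Lp_two _ _))
    ((((integrable_mul_Lp_two _ _).const_mul _).const_mul _).fun_add
      ((integrable_mul_Lp_two _ _).const_mul _))
    ((((integrable_mul_Lp_two _ _).fun_add (integrable_mul_Lp_two _ _)).const_mul _).fun_add
      ((integrable_mul_Lp_two _ _).fun_add (integrable_mul_Lp_two _ _)))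
    (memLp_two_mul _ _) ((memLp_two_mul _ _).const_mul _)
    ((memLp_two_mul _ _).add (memLp_two_mul _ _))
    (lam ^ 2 / (2 * C)) (B ^ 2 / (2 * C)) C fun t => ?_
  filter_upwards [hD t, Lp.coeFn_add x.1 (t • y.1), Lp.coeFn_add x.2.1 (t • y.2.1),
    Lp.coeFn_add x.2.2 (t • y.2.2), Lp.coeFn_smul t y.1, Lp.coeFn_smul t y.2.1,
    Lp.coeFn_smul t y.2.2, Lp.coeFn_smul t z.1, Lp.coeFn_smul t z.2.1,
    Lp.coeFn_smul t z.2.2] with s h0 a1 a2 a3 b1 b2 b3 c1 c2 c3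
  rw [h0]
  simp only [Prod.fst_add, Prod.snd_add, Prod.smul_fst, Prod.smul_snd, a1, a2, a3, c1, c2, c3,
    Pi.add_apply, b1, b2, b3, Pi.smul_apply, smul_eq_mul]
  ring

/-- With off-diagonal component 0 the line computation becomes that of `H` along `p + t * y`, whose
minimum is at `t = 0`. -/
theorem IsScalarMinimizer.firstVariation_eq_zero {B C b lam ε : ℝ} {p : ℝ × ℝ → ℝ}
    (hp : IsScalarMinimizer B C b lam ε p) {x y : Triple} (hx : Represents x p)
    (hy : y ∈ closure (testTriples : Set Triple)) : firstVariation B C b lam x y = 0 := by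
  have hyr := represents_of_mem_closure hy
  have hr : ∀ t : ℝ, Represents (x + t • y) fun z => p z + t * y.1 z :=
    fun t => hx.add (hyr.const_mul t)
  have hadm : ∀ t : ℝ, ScalarAdmissible B C ε fun z => p z + t * y.1 z := fun t =>
    ⟨(hr t).memH1, (hp.1.2.add ((hyr.memH10 hy).const_mul t)).congr fun z => by ring⟩
  have hD := (hasDerivAt_energy_line (B := B) (C := C) (b := b) (lam := lam) (x := x) (y := y)
    (z := 0) (D := fun t => scalarDensity B C b lam fun z => p z + t * y.1 z) fun t => by
      filter_upwards [(hr t).scalarDensity_ae_eq B C b lam, Lp.coeFn_zero ℝ 4 mu,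
        Lp.coeFn_zero ℝ 2 mu] with z h1 h2 h3
      rw [h1]
      simp only [smul_zero, Prod.fst_zero, Prod.snd_zero, h2, h3, Pi.zero_apply]
      ring).2
  refine IsLocalMin.hasDerivAt_eq_zero (Eventually.of_forall fun t => ?_) hD
  have := (hp.2 _ (hadm t)).2
  simpa [scalarEnergy] using this

theorem MemH10.neg {u : ℝ × ℝ → ℝ} (hu : MemH10 u) : MemH10 fun z => -u z :=
  (hu.const_mul (-1)).congr fun z => by ring

theorem ScalarAdmissible.admissible {B C ε : ℝ} {p : ℝ × ℝ → ℝ} (hp : ScalarAdmissible B C ε p) :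
    Admissible B C ε fun z => !![p z, 0; 0, -p z] := by
  have hneg : MemH1 fun z => -p z := by simpa using hp.1.const_mul (-1)
  refine ⟨⟨fun i j => ?_, ae_of_all _ fun z => ⟨?_, ?_⟩⟩, fun i j => ?_⟩
  · fin_cases i <;> fin_cases j
    exacts [hp.1, MemH1.zero, MemH1.zero, hneg]
  · ext i j
    fin_cases i <;> fin_cases j <;> rfl
  · simp [Matrix.trace_fin_two]
  · fin_cases i <;> fin_cases j
    · exact hp.2
    · exact MemH10.zero.congr fun z => by simp [Pbc]
    · exact MemH10.zero.congr fun z => by simp [Pbc]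
    · refine hp.2.neg.congr fun z => ?_
      simp [Pbc]
      ring

theorem IsScalarMinimizer.isCriticalPoint {B C b lam ε : ℝ} (h0 : 0 < ε) (h1 : ε < 1 / 2)
    {p : ℝ × ℝ → ℝ} (hp : IsScalarMinimizer B C b lam ε p) :
    IsCriticalPoint B C b lam ε fun z => !![p z, 0; 0, -p z] := by
  refine ⟨hp.1.admissible, fun V hV => ?_⟩
  obtain ⟨e, he⟩ := exists_represents_bc11 B C h0 h1
  obtain ⟨x₀, -, hx⟩ := hp.1.exists_represents he
  obtain ⟨y, hy, hyV⟩ := (hV.1 0 0).exists_represents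
  obtain ⟨z, -, hzV⟩ := (hV.1 0 1).exists_represents
  have hzV' : Represents z fun s => V s 1 0 := hzV.congr (by
    filter_upwards [hV.2] with s hs
    exact hs.1.apply 1 0)
  have hyV' : Represents ((-1 : ℝ) • y) fun s => V s 1 1 := (hyV.const_mul (-1)).congr (by
    filter_upwards [hV.2] with s hs
    have := hs.2
    rw [Matrix.trace_fin_two] at this
    linarith)
  have h := hasDerivAt_energy_line (B := B) (C := C) (b := b) (lam := lam) (x := e + x₀) (y := y)
    (z := z) (D := fun t => energyDensity B C b lam ((fun s => !![p s, 0; 0, -p s]) + t • V))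
    fun t => by
      refine energyDensity_ae_eq B C b lam ?_ ?_ ?_ ?_
      · refine (hx.add (hyV.const_mul t)).congr (ae_of_all _ fun s => ?_)
        simp
      · refine (hzV.const_mul t).congr (ae_of_all _ fun s => ?_)
        simp
      · refine (hzV'.const_mul t).congr (ae_of_all _ fun s => ?_)
        simp
      · rw [smul_add, smul_comm (-1 : ℝ) t y]
        refine ((hx.const_mul (-1)).add (hyV'.const_mul t)).congr (ae_of_all _ fun s => ?_)
        simp
  -- The derivative of `E` along `V` is the first variation of `H` along the entry `V₁₁` alone,
  -- which vanishes by minimality.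
  rw [hp.firstVariation_eq_zero hx hy] at h
  exact h

end RLdG

end

theorem mainTheorem4 (B C b lam ε : ℝ) (hB : 0 < B) (hC : 0 < C) (hε : 0 < ε)
    (hε' : ε < 1 / 2) (hb : 1 ≤ b) (hlam : 0 ≤ lam) :
    (∃ P : RLdG.Field, RLdG.Admissible B C ε P ∧ RLdG.IsCriticalPoint B C b lam ε P ∧
      (∀ z ∈ RLdG.Omega, P z 0 1 = 0) ∧
      RLdG.IsScalarMinimizer B C b lam ε (fun z => P z 0 0)) ∧
    (∀ p : ℝ × ℝ → ℝ, RLdG.IsScalarMinimizer B C b lam ε p →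
      RLdG.IsCriticalPoint B C b lam ε (fun z => !![p z, 0; 0, -p z])) := by
  refine ⟨?_, fun p hp => hp.isCriticalPoint hε hε'⟩
  obtain ⟨p, hp⟩ := RLdG.exists_isScalarMinimizer B hC hb lam hε hε'
  exact ⟨fun z => !![p z, 0; 0, -p z], hp.1.admissible, hp.isCriticalPoint hε hε',
    fun z _ => rfl, hp⟩
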